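/- **Setting.** Let $n\ge 2$, let $\mathcal G=(V,E)$, $V=[n]$, be a connected, non-bipartite (simple, undirected) graph, and let $(p_e)_{e\in E}$ be a probability distribution on $E$ with $p_e>0$ for every $e\in E$. Let $\alpha\in(0,1/2)$, $m=\lfloor\alpha n\rfloor$, and let $X=(X_1,\dots,X_n)\in\mathbb R^n$ have pairwise distinct entries, with ranks $r_k=1+\#\{l: X_k>X_l\}$ and $\alpha$-trimmed mean $$\bar x_\alpha=\frac1{n-2m}\sum_{k:\ m+1\le r_k\le n-m}X_k .$$ Put $a=m+\tfrac12$, $b=n-m+\tfrac12$ and $w_{n,\alpha}(x)=\mathbb I_{\{a\le x\le b\}}/(1-2m/n)$. **Adaptive GoTrim.** Initialize $Y_k=X_k$, $R'_k=0$, $C_k=1$, $W_k=N_k=M_k=0$ for all $k$. At each iteration draw, independently of the past, an edge $e=\{i,j\}\in E$ with probability $p_e$. For each active node $k$ (asynchronous version: $k\in\{i,j\}$; synchronous version: all $k\in[n]$) set $R'_k\leftarrow(1-1/C_k)R'_k+(1/C_k)\mathbb I_{\{X_k>Y_k\}}$, $C_k\leftarrow C_k+1$, $W'_k\leftarrow w_{n,\alpha}(nR'_k+1)$,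 $N_k\leftarrow N_k+(W'_k-W_k)X_k$, $M_k\leftarrow M_k+(W'_k-W_k)$, $W_k\leftarrow W'_k$. Then replace $N_i,N_j$ by $(N_i+N_j)/2$ and $M_i,M_j$ by $(M_i+M_j)/2$, and swap $Y_i\leftrightarrow Y_j$. After $t$ iterations the estimate is $Z_k(t)=N_k(t)/\max(1,M_k(t))$. **Constants.** With $L_e=(\mathbf e_i-\mathbf e_j)(\mathbf e_i-\mathbf e_j)^\top$ for $e=\{i,j\}$, let $c$ be the second smallest eigenvalue of $\sum_{e\in E}p_eL_e$, let $\lambda_2(2)$ be the second largest eigenvalue of $I_n-\frac12\sum_{e\in E}p_eL_e$, and $\tilde c=1-\sqrt{\lambda_2(2)}$. Let $\mathbf K=(K_k)_{k\in[n]}$ with $$K_k=\frac{\sqrt6\,\sigma_n(r_k)}{\gamma_k(1-2\alpha)},\quad \sigma_n(r)=n^{3/2}\sqrt{\tfrac{r-1}n\left(1-\tfrac{r-1}n\right)},\quad \gamma_k=\min(|r_k-a|,|r_k-b|).$$ Let $\odot$ be the entrywise product, $|X|=(|X_1|,\dots,|X_n|)$, and $\|\cdot\|=\|\cdot\|_2$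 the Euclidean norm. **Theorem 4.** There is an absolute constant $C>0$ such that in the above setting, for the asynchronous as well as the synchronous version of Adaptive GoTrim: 1. There is $T^*>0$ such that for every integer $t>T^*$ $$\mathbb E\,\|Z(t)-\bar x_\alpha\mathbf 1_n\|_2\le\frac{C}{\tilde c\sqrt{ct}}\,\big\|\mathbf K\odot(X+|\bar x_\alpha|\mathbf 1_n)\big\| .$$ 2. There is $T^*>0$, depending only on the graph, on $(p_e)_{e\in E}$ and on the version of the algorithm, and not on $\alpha$ or $X$, such that for all $\alpha\in(0,1/2)$, all $X$ with pairwise distinct entries and every integer $t>T^*$ $$\mathbb E\,\|Z(t)-\bar x_\alpha\mathbf 1_n\|_2\le\frac{C}{\tilde c\sqrt{ct}}\,\big\|\mathbf K\odot(|X|+|\bar x_\alpha|\mathbf 1_n)\big\| .$$ -/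

import Mathlib

namespace GoTrim

noncomputable section

open MeasureTheory ProbabilityTheory

variable {n : ℕ}

/-! ### Edge sampling and the weighted graph Laplacian -/

/-- The transposition of the two endpoints of an (unordered) edge. -/
def edgeSwap : Sym2 (Fin n) → Equiv.Perm (Fin n) :=
  Sym2.lift ⟨fun i j => Equiv.swap i j, fun i j => Equiv.swap_comm i j⟩

/-- The elementary Laplacian `(e_i - e_j) (e_i - e_j)ᵀ` of the edge `{i, j}`. -/
def edgeLaplacian : Sym2 (Fin n) → Matrix (Fin n) (Fin n) ℝ :=
  Sym2.lift ⟨fun i j => Matrix.vecMulVec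
      (Pi.single i (1 : ℝ) - Pi.single j 1) (Pi.single i 1 - Pi.single j 1), fun i j => by
    ext a b
    simp only [Matrix.vecMulVec_apply, Pi.sub_apply]
    ring⟩

/-- `p` is a probability distribution on the edges of `G` that charges every edge. -/
structure IsEdgeLaw (G : SimpleGraph (Fin n)) (p : Sym2 (Fin n) → ℝ) : Prop where
  pos : ∀ e ∈ G.edgeSet, 0 < p e
  zero : ∀ e, e ∉ G.edgeSet → p e = 0
  sum_eq_one : ∑ e, p e = 1

/-- The random edges `e 0, e 1, …` are independent, each with distribution `p`. -/
structure IsEdgeSampling {Ω : Type*} [MeasurableSpace Ω] (μ : Measure Ω)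
    (p : Sym2 (Fin n) → ℝ) (e : ℕ → Ω → Sym2 (Fin n)) : Prop where
  measurable : ∀ t, Measurable[_, ⊤] (e t)
  indep : iIndepFun (m := fun _ => ⊤) e μ
  law : ∀ t x, μ (e t ⁻¹' {x}) = ENNReal.ofReal (p x)

/-- The weighted Laplacian `L(P) = ∑ₑ pₑ Lₑ` (terms outside the edge set vanish since
there `pₑ = 0`). -/
def weightedLaplacian (p : Sym2 (Fin n) → ℝ) : Matrix (Fin n) (Fin n) ℝ :=
  ∑ e, p e • edgeLaplacian e

/-- The expected averaging matrix `W₂ = I - (1/2) ∑ₑ pₑ Lₑ`. -/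
def meanAveraging (p : Sym2 (Fin n) → ℝ) : Matrix (Fin n) (Fin n) ℝ :=
  1 - (1 / 2 : ℝ) • weightedLaplacian p

theorem edgeLaplacian_isHermitian (e : Sym2 (Fin n)) : (edgeLaplacian e).IsHermitian := by
  induction e using Sym2.ind with
  | _ i j =>
    ext a b
    simp [edgeLaplacian, Matrix.vecMulVec_apply, mul_comm]

theorem weightedLaplacian_isHermitian (p : Sym2 (Fin n) → ℝ) :
    (weightedLaplacian p).IsHermitian := by
  unfold weightedLaplacian Matrix.IsHermitian
  rw [Matrix.conjTranspose_sum]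
  refine Finset.sum_congr rfl fun e _ => ?_
  rw [Matrix.conjTranspose_smul, (edgeLaplacian_isHermitian e).eq, star_trivial]

theorem meanAveraging_isHermitian (p : Sym2 (Fin n) → ℝ) :
    (meanAveraging p).IsHermitian := by
  unfold meanAveraging Matrix.IsHermitian
  rw [Matrix.conjTranspose_sub, Matrix.conjTranspose_one, Matrix.conjTranspose_smul,
    (weightedLaplacian_isHermitian p).eq, star_trivial]

/-- The spectral gap `c`: the second smallest eigenvalue of `L(P)`, with multiplicity
(`eigenvalues₀` lists the eigenvalues in decreasing order). -/
def spectralGap (hn : 2 ≤ n) (p : Sym2 (Fin n) → ℝ) : ℝ :=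
  (weightedLaplacian_isHermitian p).eigenvalues₀ ⟨n - 2, by rw [Fintype.card_fin]; omega⟩

/-- `λ₂(2)`: the second largest eigenvalue of `W₂`, with multiplicity. -/
def lambdaTwo (hn : 2 ≤ n) (p : Sym2 (Fin n) → ℝ) : ℝ :=
  (meanAveraging_isHermitian p).eigenvalues₀ ⟨1, by rw [Fintype.card_fin]; omega⟩

/-- `c̃ = 1 - √λ₂(2)`. -/
def cTilde (hn : 2 ≤ n) (p : Sym2 (Fin n) → ℝ) : ℝ := 1 - √(lambdaTwo hn p)

/-! ### Ranks, trimming weights and the trimmed mean -/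

/-- The rank `r_k = 1 + #{l : X_k > X_l}`. -/
def rank (X : Fin n → ℝ) (k : Fin n) : ℕ := 1 + (Finset.univ.filter fun l => X l < X k).card

/-- The number `m = ⌊α n⌋` of observations trimmed on each side. -/
def trimCount (n : ℕ) (α : ℝ) : ℕ := ⌊α * n⌋₊

/-- The `α`-trimmed mean: the average of the observations of rank in `[m + 1, n - m]`. -/
def trimmedMean (α : ℝ) (X : Fin n → ℝ) : ℝ :=
  ∑ k, if trimCount n α + 1 ≤ rank X k ∧ rank X k + trimCount n α ≤ n
    then X k / ((n : ℝ) - 2 * trimCount n α) else 0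

/-- Left endpoint `a = ⌊α n⌋ + 1/2` of the inclusion interval. -/
def leftEnd (n : ℕ) (α : ℝ) : ℝ := trimCount n α + 1 / 2

/-- Right endpoint `b = n - ⌊α n⌋ + 1/2` of the inclusion interval. -/
def rightEnd (n : ℕ) (α : ℝ) : ℝ := n - trimCount n α + 1 / 2

open Classical in
/-- The weight `w_{n,α}(x) = 𝟙{x ∈ [a, b]} / (1 - 2 m / n)` of an estimated rank `x`. -/
def weight (n : ℕ) (α x : ℝ) : ℝ :=
  if x ∈ Set.Icc (leftEnd n α) (rightEnd n α) then 1 / (1 - 2 * trimCount n α / n) else 0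

/-- `σ_n(r) = n^{3/2} φ((r - 1) / n)` with `φ(u) = √(u (1 - u))`. -/
def sigma (n : ℕ) (r : ℝ) : ℝ := (n : ℝ) ^ (3 / 2 : ℝ) * √((r - 1) / n * (1 - (r - 1) / n))

/-- `γ_k = min(|r_k - a|, |r_k - b|)`. -/
def gamma (α : ℝ) (X : Fin n → ℝ) (k : Fin n) : ℝ :=
  min |(rank X k : ℝ) - leftEnd n α| |(rank X k : ℝ) - rightEnd n α|

/-- The vector `K` with entries `√6 σ_n(r_k) / (γ_k (1 - 2 α))`. -/
def kVec (α : ℝ) (X : Fin n → ℝ) (k : Fin n) : ℝ :=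
  √6 * sigma n (rank X k) / (gamma α X k * (1 - 2 * α))

/-! ### The algorithm -/

/-- Which nodes refresh their rank estimate and weight at an iteration: all nodes
(synchronous), or only the two endpoints of the drawn edge (asynchronous). -/
inductive Schedule
  | synchronous
  | asynchronous

/-- Node `k` is refreshed when edge `e` is drawn. -/
def Schedule.Active : Schedule → Sym2 (Fin n) → Fin n → Prop
  | .synchronous, _, _ => True
  | .asynchronous, e, k => k ∈ e

/-- The local variables of all nodes. -/
structure State (n : ℕ) where
  /-- auxiliary observation `Y_k` -/
  aux : Fin n → ℝ
  /-- normalized rank estimate `R'_k` -/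
  normRank : Fin n → ℝ
  /-- counter `C_k` (one plus the number of refreshments of node `k` so far) -/
  count : Fin n → ℕ
  /-- weight `W_k` -/
  wt : Fin n → ℝ
  /-- numerator `N_k` -/
  num : Fin n → ℝ
  /-- estimate `M_k` of the average weight -/
  mass : Fin n → ℝ

/-- Initialization: `Y = X`, `R' = 0`, `C = 1`, `W = N = M = 0`. -/
def State.init (X : Fin n → ℝ) : State n :=
  ⟨X, fun _ => 0, fun _ => 1, fun _ => 0, fun _ => 0, fun _ => 0⟩

/-- Averaging of a vector along an edge: both endpoints take the mean of their values. -/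
def average (e : Sym2 (Fin n)) (v : Fin n → ℝ) (k : Fin n) : ℝ :=
  if k ∈ e then (v k + v (edgeSwap e k)) / 2 else v k

open Classical in
/-- One iteration of Adaptive GoTrim (with GoRank as ranking algorithm) when edge `e` is drawn:
active nodes refresh `R'`, the rank estimate `R = n R' + 1`, the weight, `N` and `M`; then the
endpoints of `e` average `N` and `M` and swap their auxiliary observations. -/
def step (mode : Schedule) (α : ℝ) (X : Fin n → ℝ) (s : State n) (e : Sym2 (Fin n)) : State n :=
  let R' : Fin n → ℝ := fun k =>
    if mode.Active e k then
      (1 - 1 / (s.count k : ℝ)) * s.normRank k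
        + (1 / (s.count k : ℝ)) * (if s.aux k < X k then 1 else 0)
    else s.normRank k
  let W' : Fin n → ℝ := fun k =>
    if mode.Active e k then weight n α (n * R' k + 1) else s.wt k
  { aux := fun k => s.aux (edgeSwap e k)
    normRank := R'
    count := fun k => if mode.Active e k then s.count k + 1 else s.count k
    wt := W'
    num := average e fun k => s.num k + (W' k - s.wt k) * X k
    mass := average e fun k => s.mass k + (W' k - s.wt k) }

/-- The state after `t` iterations along the edge sequence `e 0, e 1, …`. -/
def run (mode : Schedule) (α : ℝ) (X : Fin n → ℝ) (e : ℕ → Sym2 (Fin n)) : ℕ → State n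
  | 0 => State.init X
  | t + 1 => step mode α X (run mode α X e t) (e t)

/-- The Adaptive GoTrim estimate `Z_k(t) = N_k(t) / max(1, M_k(t))`. -/
def estimate (mode : Schedule) (α : ℝ) (X : Fin n → ℝ) (e : ℕ → Sym2 (Fin n)) (t : ℕ)
    (k : Fin n) : ℝ :=
  (run mode α X e t).num k / max 1 ((run mode α X e t).mass k)

/-- The Euclidean norm of a vector. -/
def l2norm (v : Fin n → ℝ) : ℝ := ‖WithLp.toLp 2 v‖

end

end GoTrim

namespace GoTrim

noncomputable section

open MeasureTheory ProbabilityTheory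

variable {n : ℕ}

/-! ### The Dirichlet form of the weighted graph -/

/-! The mean error in fact decays geometrically, like `√(K (t + 1) r ^ t)` times a scale of the
data, with `K` and `r` depending only on the graph, the edge law and the schedule
(`exists_error_bound`). Such a bound eventually falls below any fixed multiple of `1 / √t`, so `C =
1` suffices.

Geometric decay comes from two sources. Weights: the ends of the inclusion interval are
half-integers and the true ranks are integers, so a weight is correct as soon as the rank estimate
is off by less than `1 / 2`. The estimate is a time average of indicators carried around by random
swaps. Adding a corrector that solves a Poisson equation for the Laplacian turns its accumulated
error, minus the tolerance, into a process with bounded increments and negative drift; an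
exponential supermartingale then makes a wrong weight geometrically unlikely
(`exists_weight_bound`). Accumulators: averaging preserves the total, which always equals `∑ W k * y
k`, and contracts the dispersion by the Poincaré inequality, so numerators tend to the trimmed mean
and masses to `1` (`exists_accumulator_bound`).

It remains to compare scales. For fixed data, positivity of the right-hand side is enough. For a
threshold uniform in the data, the right-hand norm must dominate the scale (`scale_le`). The entry
of `kVec` at rank one is zero, so that observation is not controlled directly: if it is trimmed, its
weight is always zero and it never enters; if nothing is trimmed, it is recovered from the mean and
the other observations. Non-bipartiteness serves to give `3 ≤ n`, which makes the right-hand norms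
positive. -/

theorem edgeSwap_edgeSwap (e : Sym2 (Fin n)) (k : Fin n) : edgeSwap e (edgeSwap e k) = k := by
  induction e using Sym2.ind with
  | _ i j => simp [edgeSwap]

theorem sum_comp_edgeSwap (e : Sym2 (Fin n)) (f : Fin n → ℝ) :
    ∑ k, f (edgeSwap e k) = ∑ k, f k :=
  Equiv.sum_comp (edgeSwap e) f

theorem edgeSwap_of_notMem {e : Sym2 (Fin n)} {k : Fin n} (hk : k ∉ e) : edgeSwap e k = k := by
  induction e using Sym2.ind with
  | _ i j =>
    rw [Sym2.mem_iff, not_or] at hk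
    exact Equiv.swap_apply_of_ne_of_ne hk.1 hk.2

theorem average_eq (e : Sym2 (Fin n)) (v : Fin n → ℝ) (k : Fin n) :
    average e v k = (v k + v (edgeSwap e k)) / 2 := by
  unfold average
  split_ifs with h
  · rfl
  · rw [edgeSwap_of_notMem h]; ring

theorem sum_average (e : Sym2 (Fin n)) (v : Fin n → ℝ) : ∑ k, average e v k = ∑ k, v k := by
  simp_rw [average_eq, ← Finset.sum_div, Finset.sum_add_distrib, sum_comp_edgeSwap]
  ring

theorem edgeLaplacian_mulVec (e : Sym2 (Fin n)) (v : Fin n → ℝ) (k : Fin n) :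
    (edgeLaplacian e).mulVec v k = v k - v (edgeSwap e k) := by
  induction e using Sym2.ind with
  | _ i j =>
    have h : (edgeLaplacian s(i, j)).mulVec v k =
        ((Pi.single i (1 : ℝ) : Fin n → ℝ) k - (Pi.single j (1 : ℝ) : Fin n → ℝ) k)
          * (v i - v j) := by
      change ∑ b, Matrix.vecMulVec _ _ k b * v b = _
      simp only [Matrix.vecMulVec_apply, Pi.sub_apply, mul_assoc, ← Finset.mul_sum, sub_mul,
        Finset.sum_sub_distrib]
      simp [Pi.single_apply]
    rw [h]
    change _ = v k - v (Equiv.swap i j k)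
    by_cases hi : k = i
    · subst hi
      by_cases hj : k = j
      · subst hj; simp
      · simp [hj]
    · by_cases hj : k = j
      · subst hj; simp [hi]
      · simp [hi, hj, Equiv.swap_apply_of_ne_of_ne hi hj]

theorem weightedLaplacian_mulVec (p : Sym2 (Fin n) → ℝ) (v : Fin n → ℝ) (k : Fin n) :
    (weightedLaplacian p).mulVec v k = ∑ e, p e * (v k - v (edgeSwap e k)) := by
  simp only [weightedLaplacian, Matrix.sum_mulVec, Finset.sum_apply, Matrix.smul_mulVec,
    Pi.smul_apply, edgeLaplacian_mulVec, smul_eq_mul]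

/-- The Dirichlet form `∑ₑ pₑ (v_i - v_j) (w_i - w_j)`, up to the factor `2`. -/
def dirichlet (p : Sym2 (Fin n) → ℝ) (v w : Fin n → ℝ) : ℝ :=
  ∑ e, ∑ k, p e * ((v k - v (edgeSwap e k)) * (w k - w (edgeSwap e k)))

/-- Summation by parts: reindexing by the swap flips the sign of the difference. The factor `2`
appears because `dirichlet` meets each edge at both endpoints. -/
theorem sum_mulVec_mul (p : Sym2 (Fin n) → ℝ) (v w : Fin n → ℝ) :
    ∑ k, (weightedLaplacian p).mulVec v k * w k = dirichlet p v w / 2 := by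
  have h : ∀ e : Sym2 (Fin n), ∑ k, p e * ((v k - v (edgeSwap e k)) * w (edgeSwap e k))
      = - ∑ k, p e * ((v k - v (edgeSwap e k)) * w k) := fun e => by
    rw [← sum_comp_edgeSwap e, ← Finset.sum_neg_distrib]
    refine Finset.sum_congr rfl fun k _ => ?_
    rw [edgeSwap_edgeSwap]; ring
  have h2 : dirichlet p v w = ∑ e, 2 * ∑ k, p e * ((v k - v (edgeSwap e k)) * w k) := by
    refine Finset.sum_congr rfl fun e _ => ?_
    simp only [mul_sub, Finset.sum_sub_distrib] at h ⊢
    linarith [h e]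
  rw [h2, ← Finset.mul_sum, Finset.sum_comm]
  simp only [weightedLaplacian_mulVec, Finset.sum_mul]
  simp only [mul_assoc]
  ring

theorem dirichlet_nonneg {p : Sym2 (Fin n) → ℝ} (hp : ∀ e, 0 ≤ p e) (v : Fin n → ℝ) :
    0 ≤ dirichlet p v v :=
  Finset.sum_nonneg fun e _ => Finset.sum_nonneg fun _ _ =>
    mul_nonneg (hp e) (mul_self_nonneg _)

theorem IsEdgeLaw.nonneg {G : SimpleGraph (Fin n)} {p : Sym2 (Fin n) → ℝ} (hp : IsEdgeLaw G p)
    (e : Sym2 (Fin n)) : 0 ≤ p e := by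
  by_cases h : e ∈ G.edgeSet
  · exact (hp.pos e h).le
  · exact (hp.zero e h).ge

/-- On a connected graph a vector of nonpositive Dirichlet energy is constant. -/
theorem const_of_dirichlet_nonpos {G : SimpleGraph (Fin n)} {p : Sym2 (Fin n) → ℝ}
    (hG : G.Connected) (hp : IsEdgeLaw G p) {v : Fin n → ℝ} (hv : dirichlet p v v ≤ 0)
    (i j : Fin n) : v i = v j := by
  have hadj : ∀ i j, G.Adj i j → v i = v j := fun i j hij => by
    have h0 := hv.antisymm (dirichlet_nonneg hp.nonneg v)
    unfold dirichlet at h0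
    rw [Finset.sum_eq_zero_iff_of_nonneg fun e _ => Finset.sum_nonneg fun _ _ =>
      mul_nonneg (hp.nonneg e) (mul_self_nonneg _)] at h0
    have h1 := h0 s(i, j) (Finset.mem_univ _)
    rw [Finset.sum_eq_zero_iff_of_nonneg fun _ _ =>
      mul_nonneg (hp.nonneg _) (mul_self_nonneg _)] at h1
    have h2 := h1 i (Finset.mem_univ _)
    have h3 : edgeSwap s(i, j) i = j := Equiv.swap_apply_left i j
    rw [h3] at h2
    have := (mul_eq_zero.1 h2).resolve_left (hp.pos s(i, j) hij).ne'
    linarith [mul_self_eq_zero.1 this]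
  obtain ⟨w⟩ := hG.preconnected i j
  induction w with
  | nil => rfl
  | cons h _ ih => exact (hadj _ _ h).trans ih

theorem dirichlet_eq_zero_of_mulVec_eq_zero {p : Sym2 (Fin n) → ℝ} {v : Fin n → ℝ}
    (h : ∀ k, (weightedLaplacian p).mulVec v k = 0) : dirichlet p v v = 0 := by
  have := sum_mulVec_mul p v v
  simp only [h, zero_mul, Finset.sum_const_zero] at this
  linarith

theorem sum_mulVec (p : Sym2 (Fin n) → ℝ) (v : Fin n → ℝ) :
    ∑ k, (weightedLaplacian p).mulVec v k = 0 := by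
  simpa [dirichlet] using sum_mulVec_mul p v 1

/-- The Poisson equation `L v = 𝐞_k - 1 / n` is solvable. -/
theorem exists_poisson {G : SimpleGraph (Fin n)} {p : Sym2 (Fin n) → ℝ}
    (hG : G.Connected) (hp : IsEdgeLaw G p) (k : Fin n) :
    ∃ v : Fin n → ℝ, ∀ j, (weightedLaplacian p).mulVec v j
      = (Pi.single k (1 : ℝ) : Fin n → ℝ) j - 1 / n := by
  have hn : (n : ℝ) ≠ 0 := by
    have := k.pos; positivity
  -- Adding the sum of the entries to every coordinate removes the kernel of constants, so the
  -- perturbed map is bijective. A preimage of `Pi.single k 1` has sum `1 / n`, which supplies the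
  -- term to subtract.
  let f : (Fin n → ℝ) →ₗ[ℝ] (Fin n → ℝ) :=
    { toFun := fun v j => (weightedLaplacian p).mulVec v j + ∑ i, v i
      map_add' := fun v w => by
        ext j
        simp only [Matrix.mulVec_add, Pi.add_apply, Finset.sum_add_distrib]; ring
      map_smul' := fun c v => by
        ext j
        simp only [Matrix.mulVec_smul, Pi.smul_apply, smul_eq_mul, ← Finset.mul_sum,
          RingHom.id_apply]; ring }
  have hsum : ∀ v, ∑ j, f v j = n * ∑ i, v i := fun v => by
    simp only [f, LinearMap.coe_mk, AddHom.coe_mk, Finset.sum_add_distrib, sum_mulVec]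
    simp
  have hinj : Function.Injective f := by
    rw [← LinearMap.ker_eq_bot, LinearMap.ker_eq_bot']
    intro v hv
    have h0 : ∑ i, v i = 0 := by
      have := hsum v
      rw [hv] at this
      simpa [hn] using this.symm
    have h1 : ∀ j, (weightedLaplacian p).mulVec v j = 0 := fun j => by
      have : (weightedLaplacian p).mulVec v j + ∑ i, v i = 0 := congrFun hv j
      rwa [h0, add_zero] at this
    have hc := const_of_dirichlet_nonpos hG hp (dirichlet_eq_zero_of_mulVec_eq_zero h1).le
    ext j
    have : ∑ i, v i = n * v j := by
      rw [Finset.sum_congr rfl fun i _ => hc i j]; simp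
    rw [h0] at this
    simpa [hn] using this.symm
  obtain ⟨v, hv⟩ := LinearMap.injective_iff_surjective.1 hinj (Pi.single k 1)
  refine ⟨v, fun j => ?_⟩
  have h1 := hsum v
  rw [hv] at h1
  simp only [Finset.sum_pi_single', Finset.mem_univ, if_true] at h1
  have h2 : (weightedLaplacian p).mulVec v j + ∑ i, v i
      = (Pi.single k (1 : ℝ) : Fin n → ℝ) j := congrFun hv j
  have h3 : ∑ i, v i = 1 / n := by field_simp; linarith
  linarith

/-- The sum of squared deviations from the mean. -/
def dispersion (w : Fin n → ℝ) : ℝ := ∑ k, (w k - (∑ i, w i) / n) ^ 2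

theorem sum_sq_sub_eq (hn : 0 < n) (w : Fin n → ℝ) (c : ℝ) :
    ∑ k, (w k - c) ^ 2 = dispersion w + n * ((∑ i, w i) / n - c) ^ 2 := by
  have hn' : (n : ℝ) ≠ 0 := by positivity
  have h : ∀ k, (w k - c) ^ 2 = (w k - (∑ i, w i) / n) ^ 2
      + 2 * ((∑ i, w i) / n - c) * (w k - (∑ i, w i) / n) + ((∑ i, w i) / n - c) ^ 2 :=
    fun k => by ring
  have h2 : ∑ k, (w k - (∑ i, w i) / n) = 0 := by
    rw [Finset.sum_sub_distrib]; simp; field_simp; simp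
  rw [Finset.sum_congr rfl fun k _ => h k, Finset.sum_add_distrib, Finset.sum_add_distrib,
    ← Finset.mul_sum, h2]
  simp [dispersion]

theorem dispersion_le_sum_sq (hn : 0 < n) (w : Fin n → ℝ) : dispersion w ≤ ∑ k, w k ^ 2 := by
  have := sum_sq_sub_eq hn w 0
  simp only [sub_zero] at this
  rw [this]
  have : 0 ≤ (n : ℝ) * ((∑ i, w i) / n) ^ 2 := by positivity
  linarith

/-- The parallelogram identity at each node; the mean does not move under averaging. -/
theorem dispersion_average (e : Sym2 (Fin n)) (w : Fin n → ℝ) :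
    dispersion (average e w) = dispersion w - (∑ k, (w k - w (edgeSwap e k)) ^ 2) / 4 := by
  unfold dispersion
  rw [sum_average]
  set c := (∑ i, w i) / n
  have h := sum_comp_edgeSwap e fun k => (w k - c) ^ 2
  have h2 : ∀ k, (average e w k - c) ^ 2 = (w k - c) ^ 2 / 2 + (w (edgeSwap e k) - c) ^ 2 / 2
      - (w k - w (edgeSwap e k)) ^ 2 / 4 := fun k => by rw [average_eq]; ring
  rw [Finset.sum_congr rfl fun k _ => h2 k, Finset.sum_sub_distrib, Finset.sum_add_distrib,
    ← Finset.sum_div, ← Finset.sum_div, ← Finset.sum_div, h]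
  ring

theorem dispersion_average_le (e : Sym2 (Fin n)) (w : Fin n → ℝ) :
    dispersion (average e w) ≤ dispersion w := by
  rw [dispersion_average]
  have : 0 ≤ ∑ k, (w k - w (edgeSwap e k)) ^ 2 := Finset.sum_nonneg fun _ _ => sq_nonneg _
  linarith

theorem dispersion_add_le {η : ℝ} (hη : 0 < η) (v w : Fin n → ℝ) :
    dispersion (fun k => v k + w k) ≤ (1 + η) * dispersion v + (1 + 1 / η) * dispersion w := by
  unfold dispersion
  rw [Finset.mul_sum, Finset.mul_sum, ← Finset.sum_add_distrib]
  refine Finset.sum_le_sum fun k _ => ?_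
  rw [Finset.sum_add_distrib]
  set a := v k - (∑ i, v i) / n with ha
  set b := w k - (∑ i, w i) / n with hb
  have h1 : v k + w k - (∑ i, v i + ∑ i, w i) / n = a + b := by rw [ha, hb]; ring
  rw [h1]
  have h2 : (1 + η) * a ^ 2 + (1 + 1 / η) * b ^ 2 - (a + b) ^ 2 = (η * a - b) ^ 2 / η := by
    field_simp; ring
  have h3 : 0 ≤ (η * a - b) ^ 2 / η := by positivity
  linarith

/-- The Poincaré inequality of a connected weighted graph. -/
theorem exists_poincare {G : SimpleGraph (Fin n)} {p : Sym2 (Fin n) → ℝ}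
    (hG : G.Connected) (hp : IsEdgeLaw G p) :
    ∃ K : ℝ, 1 ≤ K ∧ ∀ w : Fin n → ℝ, dispersion w ≤ K * dirichlet p w w := by
  choose v hv using exists_poisson hG hp
  have h : ∀ (w : Fin n → ℝ) k, (w k - (∑ i, w i) / n) ^ 2
      ≤ dirichlet p (v k) (v k) * dirichlet p w w := fun w k => by
    -- Testing the Poisson equation against `w` expresses the deviation at `k` as an energy pairing,
    -- to which Cauchy–Schwarz applies.
    have h1 : w k - (∑ i, w i) / n = dirichlet p (v k) w / 2 := by
      rw [← sum_mulVec_mul]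
      simp only [hv, sub_mul, Finset.sum_sub_distrib, ← Finset.mul_sum]
      simp [Pi.single_apply]; ring
    have h2 : dirichlet p (v k) w ^ 2 ≤ dirichlet p (v k) (v k) * dirichlet p w w := by
      simp only [dirichlet, ← Finset.sum_product']
      refine Finset.sum_sq_le_sum_mul_sum_of_sq_le_mul _ ?_ ?_ ?_
      · exact fun i _ => mul_nonneg (hp.nonneg _) (mul_self_nonneg _)
      · exact fun i _ => mul_nonneg (hp.nonneg _) (mul_self_nonneg _)
      · intro i _; exact le_of_eq (by ring)
    rw [h1]
    nlinarith [sq_nonneg (dirichlet p (v k) w)]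
  refine ⟨1 + ∑ k, dirichlet p (v k) (v k), ?_, fun w => ?_⟩
  · linarith [Finset.sum_nonneg fun k (_ : k ∈ Finset.univ) =>
      dirichlet_nonneg hp.nonneg (v k)]
  · have := Finset.sum_le_sum fun k (_ : k ∈ Finset.univ) => h w k
    rw [← Finset.sum_mul] at this
    have h0 := dirichlet_nonneg hp.nonneg w
    unfold dispersion
    linarith

/-- Averaging along a random edge contracts the dispersion in mean, up to perturbations. -/
theorem exists_contraction {G : SimpleGraph (Fin n)} {p : Sym2 (Fin n) → ℝ} (hn : 0 < n)
    (hG : G.Connected) (hp : IsEdgeLaw G p) :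
    ∃ r A : ℝ, 0 < r ∧ r < 1 ∧ 0 ≤ A ∧ ∀ (w : Fin n → ℝ) (δ : Sym2 (Fin n) → Fin n → ℝ),
      ∑ e, p e * dispersion (average e fun k => w k + δ e k)
        ≤ r * dispersion w + A * ∑ e, p e * ∑ k, δ e k ^ 2 := by
  obtain ⟨K, hK, hw⟩ := exists_poincare hG hp
  have hKp : 0 < K := by linarith
  -- Averaging alone contracts by `1 - 1 / (4 K) = 1 - 2 x`; the Young factor `1 + x` paid for the
  -- perturbation still leaves a product below `1`.
  set x := 1 / (8 * K) with hx
  have hx0 : 0 < x := by positivity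
  have hx1 : x ≤ 1 / 8 := by
    rw [hx]; apply one_div_le_one_div_of_le <;> linarith
  have hxK : x * K = 1 / 8 := by rw [hx]; field_simp
  refine ⟨(1 + x) * (1 - 2 * x), 1 + 1 / x, by nlinarith, by nlinarith, by positivity,
    fun w δ => ?_⟩
  have hav : ∀ e, average e (fun k => w k + δ e k)
      = fun k => average e w k + average e (δ e) k := fun e => by
    ext k; simp only [average_eq]; ring
  have h1 : ∑ e, p e * dispersion (average e fun k => w k + δ e k)
      ≤ ∑ e, ((1 + x) * (p e * dispersion (average e w))
        + (1 + 1 / x) * (p e * ∑ k, δ e k ^ 2)) := by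
    refine Finset.sum_le_sum fun e _ => ?_
    rw [hav]
    have h2 := dispersion_add_le hx0 (average e w) (average e (δ e))
    have h3 := (dispersion_average_le e (δ e)).trans (dispersion_le_sum_sq hn (δ e))
    have h4 : dispersion (fun k => average e w k + average e (δ e) k)
        ≤ (1 + x) * dispersion (average e w) + (1 + 1 / x) * ∑ k, δ e k ^ 2 :=
      h2.trans (by gcongr)
    calc _ ≤ p e * _ := mul_le_mul_of_nonneg_left h4 (hp.nonneg e)
      _ = _ := by ring
  rw [Finset.sum_add_distrib, ← Finset.mul_sum, ← Finset.mul_sum] at h1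
  refine h1.trans (add_le_add_left ?_ _)
  rw [mul_assoc]
  refine mul_le_mul_of_nonneg_left ?_ (by positivity)
  have h5 : ∑ e, p e * dispersion (average e w) = dispersion w - dirichlet p w w / 4 := by
    have h6 : dirichlet p w w = ∑ e, p e * ∑ k, (w k - w (edgeSwap e k)) ^ 2 := by
      simp only [dirichlet, Finset.mul_sum, sq]
    rw [h6, Finset.sum_div]
    simp only [dispersion_average, mul_sub, Finset.sum_sub_distrib, ← Finset.sum_mul,
      hp.sum_eq_one, one_mul, mul_div_assoc]
  rw [h5]
  have := mul_le_mul_of_nonneg_left (hw w) hx0.le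
  nlinarith [dirichlet_nonneg hp.nonneg w]

/-! ### Positivity of the spectral constants -/

/-- Two orthogonal nonzero vectors cannot both have nonpositive Dirichlet energy. -/
theorem not_orthogonal_of_dirichlet_nonpos {G : SimpleGraph (Fin n)} {p : Sym2 (Fin n) → ℝ}
    (hG : G.Connected) (hp : IsEdgeLaw G p) {u v : EuclideanSpace ℝ (Fin n)}
    (hu : dirichlet p u u ≤ 0) (hv : dirichlet p v v ≤ 0) (hu1 : u ≠ 0) (hv1 : v ≠ 0)
    (huv : inner ℝ u v = 0) : False := by
  have cu := const_of_dirichlet_nonpos hG hp hu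
  have cv := const_of_dirichlet_nonpos hG hp hv
  obtain ⟨i, hi⟩ : ∃ i, u i ≠ 0 := by
    by_contra! h; exact hu1 (by ext i; simpa using h i)
  obtain ⟨j, hj⟩ : ∃ i, v i ≠ 0 := by
    by_contra! h; exact hv1 (by ext i; simpa using h i)
  rw [PiLp.inner_apply] at huv
  have : ∀ k, inner ℝ (u k) (v k) = u i * v j := fun k => by
    rw [cu k i, cv k j]; simp [mul_comm]
  rw [Finset.sum_congr rfl fun k _ => this k] at huv
  have := i.pos
  simp [hi, hj] at huv
  omega

/-- Distinct indices give orthogonal eigenvectors even when the eigenvalues coincide, which is what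
counting with multiplicity requires. -/
theorem eigenvalues₀_two {A : Matrix (Fin n) (Fin n) ℝ} (hA : A.IsHermitian)
    {i j : Fin (Fintype.card (Fin n))} (hij : i ≠ j) :
    ∃ u v : EuclideanSpace ℝ (Fin n), u ≠ 0 ∧ v ≠ 0 ∧ inner ℝ u v = 0 ∧
      (∀ k, A.mulVec u k = hA.eigenvalues₀ i * u k) ∧
      (∀ k, A.mulVec v k = hA.eigenvalues₀ j * v k) := by
  let φ := Fintype.equivOfCardEq (Fintype.card_fin (Fintype.card (Fin n)))
  have hφ : ∀ i, hA.eigenvalues (φ i) = hA.eigenvalues₀ i := fun i => by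
    simp [Matrix.IsHermitian.eigenvalues, φ]
  refine ⟨hA.eigenvectorBasis (φ i), hA.eigenvectorBasis (φ j),
    hA.eigenvectorBasis.orthonormal.ne_zero _, hA.eigenvectorBasis.orthonormal.ne_zero _,
    hA.eigenvectorBasis.orthonormal.2 (φ.injective.ne hij), fun k => ?_, fun k => ?_⟩
  · have := congrFun (hA.mulVec_eigenvectorBasis (φ i)) k
    rwa [hφ] at this
  · have := congrFun (hA.mulVec_eigenvectorBasis (φ j)) k
    rwa [hφ] at this

/-- Otherwise the two smallest eigenvalues would both be nonpositive, giving two orthogonal nonzero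
vectors that are both constant. -/
theorem spectralGap_pos {G : SimpleGraph (Fin n)} {p : Sym2 (Fin n) → ℝ} (hn : 2 ≤ n)
    (hG : G.Connected) (hp : IsEdgeLaw G p) : 0 < spectralGap hn p := by
  by_contra! hc
  have hL := weightedLaplacian_isHermitian p
  let i : Fin (Fintype.card (Fin n)) := ⟨n - 2, by rw [Fintype.card_fin]; omega⟩
  let j : Fin (Fintype.card (Fin n)) := ⟨n - 1, by rw [Fintype.card_fin]; omega⟩
  have hi : hL.eigenvalues₀ i ≤ 0 := hc
  have hj : hL.eigenvalues₀ j ≤ 0 :=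
    (hL.eigenvalues₀_antitone (show i ≤ j from by simp [i, j]; omega)).trans hi
  have hij : i ≠ j := by simp [i, j]; omega
  obtain ⟨u, v, hu, hv, huv, eu, ev⟩ := eigenvalues₀_two hL hij
  have key : ∀ (w : EuclideanSpace ℝ (Fin n)) (c : ℝ), c ≤ 0 →
      (∀ k, (weightedLaplacian p).mulVec w k = c * w k) → dirichlet p w w ≤ 0 :=
    fun w c hc hw => by
      have h := sum_mulVec_mul p w w
      simp only [hw, mul_assoc, ← Finset.mul_sum] at h
      have : 0 ≤ ∑ k, w k * w k := Finset.sum_nonneg fun _ _ => mul_self_nonneg _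
      nlinarith
  exact not_orthogonal_of_dirichlet_nonpos hG hp (key u _ hi eu) (key v _ hj ev) hu hv huv

theorem lambdaTwo_lt_one {G : SimpleGraph (Fin n)} {p : Sym2 (Fin n) → ℝ} (hn : 2 ≤ n)
    (hG : G.Connected) (hp : IsEdgeLaw G p) : lambdaTwo hn p < 1 := by
  by_contra! hc
  have hL := meanAveraging_isHermitian p
  let i : Fin (Fintype.card (Fin n)) := ⟨1, by rw [Fintype.card_fin]; omega⟩
  let j : Fin (Fintype.card (Fin n)) := ⟨0, by rw [Fintype.card_fin]; omega⟩
  have hi : 1 ≤ hL.eigenvalues₀ i := hc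
  have hj : 1 ≤ hL.eigenvalues₀ j :=
    hi.trans (hL.eigenvalues₀_antitone (show j ≤ i from by simp [i, j]))
  have hij : i ≠ j := by simp [i, j]
  obtain ⟨u, v, hu, hv, huv, eu, ev⟩ := eigenvalues₀_two hL hij
  have key : ∀ (w : EuclideanSpace ℝ (Fin n)) (c : ℝ), 1 ≤ c →
      (∀ k, (meanAveraging p).mulVec w k = c * w k) → dirichlet p w w ≤ 0 :=
    fun w c hc hw => by
      -- An eigenvalue `c ≥ 1` of the averaging matrix is an eigenvalue `2 (1 - c) ≤ 0` of the
      -- Laplacian.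
      have hw' : ∀ k, (weightedLaplacian p).mulVec w k = 2 * (1 - c) * w k := fun k => by
        have := hw k
        simp only [meanAveraging, Matrix.sub_mulVec, Matrix.one_mulVec, Matrix.smul_mulVec,
          Pi.sub_apply, Pi.smul_apply, smul_eq_mul] at this
        linarith
      have h := sum_mulVec_mul p w w
      simp only [hw', mul_assoc, ← Finset.mul_sum] at h
      have : 0 ≤ ∑ k, w k * w k := Finset.sum_nonneg fun _ _ => mul_self_nonneg _
      nlinarith
  exact not_orthogonal_of_dirichlet_nonpos hG hp (key u _ hi eu) (key v _ hj ev) hu hv huv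

theorem cTilde_pos {G : SimpleGraph (Fin n)} {p : Sym2 (Fin n) → ℝ} (hn : 2 ≤ n)
    (hG : G.Connected) (hp : IsEdgeLaw G p) : 0 < cTilde hn p := by
  have : √(lambdaTwo hn p) < 1 := by
    rw [Real.sqrt_lt' one_pos]; simpa using lambdaTwo_lt_one hn hG hp
  unfold cTilde; linarith

/-! ### Expectations over edge histories -/

/-- The history of the first `t` edges, the most recent one first. -/
def history (e : ℕ → Sym2 (Fin n)) : ℕ → List (Sym2 (Fin n))
  | 0 => []
  | t + 1 => e t :: history e t

/-- The mean of a function of the history of `t` independent edges of law `p`. -/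
def pathMean (p : Sym2 (Fin n) → ℝ) : ℕ → (List (Sym2 (Fin n)) → ℝ) → ℝ
  | 0, F => F []
  | t + 1, F => pathMean p t fun l => ∑ x, p x * F (x :: l)

theorem pathMean_mono {p : Sym2 (Fin n) → ℝ} (hp : ∀ e, 0 ≤ p e) (t : ℕ)
    {F H : List (Sym2 (Fin n)) → ℝ} (h : ∀ l, F l ≤ H l) : pathMean p t F ≤ pathMean p t H := by
  induction t generalizing F H with
  | zero => exact h []
  | succ t ih =>
    exact ih fun l => Finset.sum_le_sum fun x _ => mul_le_mul_of_nonneg_left (h _) (hp x)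

theorem pathMean_add (p : Sym2 (Fin n) → ℝ) (t : ℕ) (F H : List (Sym2 (Fin n)) → ℝ) :
    pathMean p t (fun l => F l + H l) = pathMean p t F + pathMean p t H := by
  induction t generalizing F H with
  | zero => rfl
  | succ t ih => simp only [pathMean, mul_add, Finset.sum_add_distrib, ih]

theorem pathMean_const_mul (p : Sym2 (Fin n) → ℝ) (t : ℕ) (c : ℝ)
    (F : List (Sym2 (Fin n)) → ℝ) :
    pathMean p t (fun l => c * F l) = c * pathMean p t F := by
  induction t generalizing F with
  | zero => rfl
  | succ t ih =>
    simp only [pathMean, ← ih, Finset.mul_sum]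
    congr 1; ext l; exact Finset.sum_congr rfl fun x _ => by ring

theorem pathMean_sum {ι : Type*} (s : Finset ι) (p : Sym2 (Fin n) → ℝ) (t : ℕ)
    (F : ι → List (Sym2 (Fin n)) → ℝ) :
    pathMean p t (fun l => ∑ i ∈ s, F i l) = ∑ i ∈ s, pathMean p t (F i) := by
  induction t generalizing F with
  | zero => rfl
  | succ t ih =>
    simp only [pathMean, ← ih, Finset.mul_sum]
    congr 1; ext l; exact Finset.sum_comm

theorem pathMean_const {p : Sym2 (Fin n) → ℝ} (hp : ∑ e, p e = 1) (t : ℕ) (c : ℝ) :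
    pathMean p t (fun _ => c) = c := by
  induction t with
  | zero => rfl
  | succ t ih => simpa only [pathMean, ← Finset.sum_mul, hp, one_mul] using ih

/-- A function of the history whose mean is multiplied by at most `ρ` at each draw
decays geometrically. -/
theorem pathMean_le_pow {p : Sym2 (Fin n) → ℝ} (hp : ∀ e, 0 ≤ p e) {ρ : ℝ} (hρ : 0 ≤ ρ)
    {F : List (Sym2 (Fin n)) → ℝ} (h : ∀ l, ∑ x, p x * F (x :: l) ≤ ρ * F l) (t : ℕ) :
    pathMean p t F ≤ ρ ^ t * F [] := by
  induction t with
  | zero => simp [pathMean]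
  | succ t ih =>
    calc pathMean p (t + 1) F ≤ pathMean p t (fun l => ρ * F l) := pathMean_mono hp t h
      _ = ρ * pathMean p t F := pathMean_const_mul ..
      _ ≤ ρ * (ρ ^ t * F []) := by gcongr
      _ = _ := by ring

/-- Jensen's inequality for the square, through the pointwise bound `F ≤ d / 2 + F ^ 2 / (2 d)`. -/
theorem pathMean_le_of_sq_le {p : Sym2 (Fin n) → ℝ} (hp : ∀ e, 0 ≤ p e)
    (hp1 : ∑ e, p e = 1) (t : ℕ) {F : List (Sym2 (Fin n)) → ℝ} {d : ℝ} (hd : 0 < d)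
    (h : pathMean p t (fun l => F l ^ 2) ≤ d ^ 2) : pathMean p t F ≤ d := by
  have h1 : pathMean p t F ≤ pathMean p t fun l => d / 2 + 1 / (2 * d) * F l ^ 2 := by
    refine pathMean_mono hp t fun l => ?_
    have : d / 2 + 1 / (2 * d) * F l ^ 2 - F l = (F l - d) ^ 2 / (2 * d) := by field_simp; ring
    have : 0 ≤ (F l - d) ^ 2 / (2 * d) := by positivity
    linarith
  rw [pathMean_add, pathMean_const hp1, pathMean_const_mul] at h1
  have h2 : 1 / (2 * d) * pathMean p t (fun l => F l ^ 2) ≤ 1 / (2 * d) * d ^ 2 := by gcongr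
  have h3 : 1 / (2 * d) * d ^ 2 = d / 2 := by field_simp
  linarith

theorem exists_history_eq (t : ℕ) : ∃ f : ((i : Finset.range t) → Sym2 (Fin n)) →
    List (Sym2 (Fin n)), ∀ e : ℕ → Sym2 (Fin n), history e t = f fun i => e i := by
  induction t with
  | zero => exact ⟨fun _ => [], fun _ => rfl⟩
  | succ t ih =>
    obtain ⟨f, hf⟩ := ih
    refine ⟨fun y => y ⟨t, by simp⟩ :: f fun i => y ⟨i, ?_⟩, fun e => ?_⟩
    · have := Finset.mem_range.1 i.2
      exact Finset.mem_range.2 (by omega)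
    · simp only [history, hf]

/-- The only use of the probability space: the latest edge is independent of the earlier ones, so
integrating it out leaves a function of the shorter history. All later estimates concern the finite
sums `pathMean`. -/
theorem integral_history {Ω : Type*} [MeasurableSpace Ω] {μ : Measure Ω}
    [IsProbabilityMeasure μ] {p : Sym2 (Fin n) → ℝ} (hp : ∀ e, 0 ≤ p e)
    {e : ℕ → Ω → Sym2 (Fin n)} (he : IsEdgeSampling μ p e) (t : ℕ)
    (F : List (Sym2 (Fin n)) → ℝ) :
    ∫ ω, F (history (fun s => e s ω) t) ∂μ = pathMean p t F := by
  let _ : MeasurableSpace (Sym2 (Fin n)) := ⊤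
  have : DiscreteMeasurableSpace (Sym2 (Fin n)) := ⟨fun _ => trivial⟩
  have hm : ∀ t, Measurable (e t) := he.measurable
  induction t generalizing F with
  | zero => simp [history, pathMean]
  | succ t ih =>
    obtain ⟨f, hf⟩ := exists_history_eq (n := n) t
    let Y : Ω → ((i : Finset.range t) → Sym2 (Fin n)) := fun ω i => e i ω
    have hY : Measurable Y := measurable_pi_lambda _ fun i => hm i
    have hind : IndepFun (e t) Y μ := by
      have h := he.indep.indepFun_finset {t} (Finset.range t) (by simp) hm
      have hφ : Measurable fun y : ({t} : Finset ℕ) → Sym2 (Fin n) => y ⟨t, by simp⟩ :=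
        measurable_pi_apply _
      exact h.comp hφ measurable_id
    have hint : ∀ g : ((i : Finset.range t) → Sym2 (Fin n)) → ℝ,
        Integrable (fun ω => g (Y ω)) μ := fun g => by
      refine Integrable.of_bound (C := ∑ y, |g y|)
        ((Measurable.of_discrete (f := g)).comp hY).aestronglyMeasurable
        (Filter.Eventually.of_forall fun ω => ?_)
      exact Finset.single_le_sum (f := fun y => |g y|) (fun _ _ => abs_nonneg _)
        (Finset.mem_univ (Y ω))
    have hx : ∀ x, ∫ ω, (if e t ω = x then (1 : ℝ) else 0) * F (x :: f (Y ω)) ∂μ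
        = p x * ∫ ω, F (x :: f (Y ω)) ∂μ := fun x => by
      have h := hind.comp (φ := fun y => if y = x then (1 : ℝ) else 0)
        (ψ := fun y => F (x :: f y)) Measurable.of_discrete Measurable.of_discrete
      have h2 := h.integral_fun_mul_eq_mul_integral
        ((Measurable.of_discrete.comp (hm t)).aestronglyMeasurable)
        ((Measurable.of_discrete.comp hY).aestronglyMeasurable)
      refine h2.trans ?_
      congr 1
      have h3 : (fun ω => if e t ω = x then (1 : ℝ) else 0)
          = (e t ⁻¹' {x}).indicator fun _ => (1 : ℝ) := by
        funext ω
        by_cases h : e t ω = x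
        · rw [if_pos h, Set.indicator_of_mem (show ω ∈ e t ⁻¹' {x} from h)]
        · rw [if_neg h, Set.indicator_of_notMem (show ω ∉ e t ⁻¹' {x} from h)]
      change ∫ ω, (if e t ω = x then (1 : ℝ) else 0) ∂μ = p x
      rw [h3, integral_indicator (hm t (MeasurableSet.of_discrete)), setIntegral_const]
      simp [measureReal_def, he.law, ENNReal.toReal_ofReal (hp x)]
    have hint2 : ∀ x, Integrable
        (fun ω => (if e t ω = x then (1 : ℝ) else 0) * F (x :: f (Y ω))) μ := fun x => by
      refine (hint fun y => F (x :: f y)).bdd_mul (c := 1)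
        (Measurable.of_discrete (f := fun y => if y = x then (1 : ℝ) else 0)
          |>.comp (hm t)).aestronglyMeasurable (Filter.Eventually.of_forall fun ω => ?_)
      split_ifs <;> simp
    calc ∫ ω, F (history (fun s => e s ω) (t + 1)) ∂μ
        = ∫ ω, ∑ x, (if e t ω = x then (1 : ℝ) else 0) * F (x :: f (Y ω)) ∂μ := by
          refine integral_congr_ae (Filter.Eventually.of_forall fun ω => ?_)
          simp [history, hf, Y]
      _ = ∑ x, p x * ∫ ω, F (x :: f (Y ω)) ∂μ := by
          rw [integral_finsetSum _ fun x _ => hint2 x]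
          exact Finset.sum_congr rfl fun x _ => hx x
      _ = ∫ ω, ∑ x, p x * F (x :: history (fun s => e s ω) t) ∂μ := by
          simp only [hf]
          rw [integral_finsetSum _ fun x _ => (hint fun y => F (x :: f y)).const_mul (p x)]
          exact Finset.sum_congr rfl fun x _ => (integral_const_mul _ _).symm
      _ = pathMean p (t + 1) F := ih fun l => ∑ x, p x * F (x :: l)

/-! ### Averaged accumulators -/

/-- If the weights `W` approach `w` geometrically in mean square, then the accumulated and
averaged increments of `W k * y k` approach `(∑ k, w k * y k) / n` geometrically. -/
theorem exists_accumulator_bound {G : SimpleGraph (Fin n)} {p : Sym2 (Fin n) → ℝ} (hn : 0 < n)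
    (hG : G.Connected) (hp : IsEdgeLaw G p) {B ρ : ℝ} (hB : 0 ≤ B) (hρ0 : 0 ≤ ρ) (hρ : ρ < 1) :
    ∃ K r : ℝ, 0 < K ∧ 0 < r ∧ r < 1 ∧
      ∀ (W acc : List (Sym2 (Fin n)) → Fin n → ℝ) (w y : Fin n → ℝ) (S : ℝ),
        (∀ k, W [] k = 0) → (∀ k, acc [] k = 0) →
        (∀ x l, acc (x :: l) = average x fun k => acc l k + (W (x :: l) k - W l k) * y k) →
        (∀ t k, pathMean p t (fun l => (W l k - w k) ^ 2) ≤ B * ρ ^ t) →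
        (∀ k, |y k| ≤ S ∨ ∀ l, W l k = w k) →
        ∀ t : ℕ, pathMean p t (fun l => ∑ k, (acc l k - (∑ i, w i * y i) / n) ^ 2)
          ≤ K * (t + 1) * r ^ t * S ^ 2 := by
  obtain ⟨q, A, hq0, hq1, hA, hc⟩ := exists_contraction hn hG hp
  have hn' : (0 : ℝ) < n := by positivity
  -- The contraction rate and the rate of the forcing may coincide, whence the linear factor `t` in
  -- the bounds below.
  set r := max q ρ
  have hr0 : 0 < r := lt_max_of_lt_left hq0
  have hr1 : r < 1 := max_lt hq1 hρ
  -- Each increment is charged to the weight errors before and after it, each costing `A * 2 S ^ 2 *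
  -- n B r ^ t`; dividing by `r` lets the total read `D r ^ (t + 1) S ^ 2`.
  set D := A * (4 * (n * B)) / r
  have hD : 0 ≤ D := by positivity
  refine ⟨D + n * B + 1, r, by positivity, hr0, hr1,
    fun W acc w y S hW0 hacc0 hacc hW hy t => ?_⟩
  have hpow : ∀ t, ρ ^ t ≤ r ^ t := fun t => pow_le_pow_left₀ hρ0 (le_max_right _ _) t
  have hWr : ∀ t k, pathMean p t (fun l => (W l k - w k) ^ 2) ≤ B * r ^ t := fun t k =>
    (hW t k).trans (mul_le_mul_of_nonneg_left (hpow t) hB)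
  have hy2 : ∀ k, y k ^ 2 ≤ S ^ 2 ∨ ∀ l, W l k = w k := fun k => by
    refine (hy k).imp_left fun h => ?_
    rw [← sq_abs (y k)]
    exact pow_le_pow_left₀ (abs_nonneg _) h 2
  -- Averaging preserves the total and the increments telescope from zero.
  have hsum : ∀ l, ∑ k, acc l k = ∑ k, W l k * y k := fun l => by
    induction l with
    | nil => simp [hW0, hacc0]
    | cons x l ih =>
      rw [hacc, sum_average, Finset.sum_add_distrib, ih, ← Finset.sum_add_distrib]
      exact Finset.sum_congr rfl fun k _ => by ring
  have hδ : ∀ x l k, ((W (x :: l) k - W l k) * y k) ^ 2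
      ≤ 2 * S ^ 2 * (W (x :: l) k - w k) ^ 2 + 2 * S ^ 2 * (W l k - w k) ^ 2 := fun x l k => by
    rcases hy2 k with h | h
    · rw [mul_pow]
      calc (W (x :: l) k - W l k) ^ 2 * y k ^ 2
          ≤ (2 * (W (x :: l) k - w k) ^ 2 + 2 * (W l k - w k) ^ 2) * S ^ 2 := by
            gcongr
            nlinarith [sq_nonneg ((W (x :: l) k - w k) + (W l k - w k))]
        _ = _ := by ring
    · rw [h, h]; simp
  have hstep : ∀ l, ∑ x, p x * dispersion (acc (x :: l)) ≤ q * dispersion (acc l)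
      + (A * (2 * S ^ 2) * ∑ x, p x * ∑ k, (W (x :: l) k - w k) ^ 2
        + A * (2 * S ^ 2) * ∑ k, (W l k - w k) ^ 2) := fun l => by
    have h1 := hc (acc l) fun x k => (W (x :: l) k - W l k) * y k
    simp only [← hacc] at h1
    refine h1.trans (add_le_add_right ?_ _)
    calc A * ∑ x, p x * ∑ k, ((W (x :: l) k - W l k) * y k) ^ 2
        ≤ A * ∑ x, p x * ∑ k, (2 * S ^ 2 * (W (x :: l) k - w k) ^ 2
            + 2 * S ^ 2 * (W l k - w k) ^ 2) := by
          refine mul_le_mul_of_nonneg_left (Finset.sum_le_sum fun x _ =>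
            mul_le_mul_of_nonneg_left (Finset.sum_le_sum fun k _ => hδ x l k) (hp.nonneg x)) hA
      _ = A * (2 * S ^ 2) * ∑ x, p x * ∑ k, (W (x :: l) k - w k) ^ 2
        + A * (2 * S ^ 2) * ((∑ x, p x) * ∑ k, (W l k - w k) ^ 2) := by
          rw [Finset.sum_mul, Finset.mul_sum, Finset.mul_sum, Finset.mul_sum,
            ← Finset.sum_add_distrib]
          refine Finset.sum_congr rfl fun x _ => ?_
          rw [Finset.sum_add_distrib, ← Finset.mul_sum, ← Finset.mul_sum]
          ring
      _ = _ := by rw [hp.sum_eq_one, one_mul]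
  have hWs : ∀ t, pathMean p t (fun l => ∑ k, (W l k - w k) ^ 2) ≤ n * B * r ^ t := fun t => by
    rw [pathMean_sum]
    calc _ ≤ ∑ _k : Fin n, B * r ^ t := Finset.sum_le_sum fun k _ => hWr t k
      _ = _ := by simp; ring
  have hdisp : ∀ t : ℕ, pathMean p t (fun l => dispersion (acc l)) ≤ t * (D * r ^ t * S ^ 2) := by
    intro t
    induction t with
    | zero => simp [pathMean, dispersion, hacc0]
    | succ t ih =>
      have h1 : pathMean p (t + 1) (fun l => dispersion (acc l)) ≤ _ :=
        pathMean_mono hp.nonneg t hstep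
      rw [pathMean_add, pathMean_add, pathMean_const_mul, pathMean_const_mul,
        pathMean_const_mul] at h1
      have h2 : pathMean p t (fun l => ∑ x, p x * ∑ k, (W (x :: l) k - w k) ^ 2)
          ≤ n * B * r ^ t := by
        refine (hWs (t + 1)).trans (mul_le_mul_of_nonneg_left ?_ (by positivity))
        exact pow_le_pow_of_le_one hr0.le hr1.le (Nat.le_succ t)
      have h3 : q * pathMean p t (fun l => dispersion (acc l))
          ≤ r * (t * (D * r ^ t * S ^ 2)) := by
        have h0 : 0 ≤ (t : ℝ) * (D * r ^ t * S ^ 2) := by positivity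
        calc _ ≤ q * (t * (D * r ^ t * S ^ 2)) := mul_le_mul_of_nonneg_left ih hq0.le
          _ ≤ _ := mul_le_mul_of_nonneg_right (le_max_left _ _) h0
      have h4 : A * (2 * S ^ 2) * (n * B * r ^ t) * 2 = D * r ^ (t + 1) * S ^ 2 := by
        simp only [D, pow_succ]; field_simp; ring
      have hA2 : 0 ≤ A * (2 * S ^ 2) := by positivity
      have h5 := mul_le_mul_of_nonneg_left h2 hA2
      have h6 := mul_le_mul_of_nonneg_left (hWs t) hA2
      push_cast
      calc _ ≤ _ := h1
        _ ≤ r * (t * (D * r ^ t * S ^ 2)) + A * (2 * S ^ 2) * (n * B * r ^ t) * 2 := by linarith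
        _ = _ := by rw [h4]; ring
  have hmean : ∀ l, (n : ℝ) * ((∑ k, acc l k) / n - (∑ i, w i * y i) / n) ^ 2
      ≤ S ^ 2 * ∑ k, (W l k - w k) ^ 2 := fun l => by
    rw [hsum, ← sub_div, ← Finset.sum_sub_distrib]
    have h1 : (∑ k, (W l k * y k - w k * y k)) ^ 2 ≤ n * ∑ k, (W l k * y k - w k * y k) ^ 2 := by
      simpa using sq_sum_le_card_mul_sum_sq (s := Finset.univ)
        (f := fun k => W l k * y k - w k * y k)
    have h2 : ∑ k, (W l k * y k - w k * y k) ^ 2 ≤ S ^ 2 * ∑ k, (W l k - w k) ^ 2 := by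
      rw [Finset.mul_sum]
      refine Finset.sum_le_sum fun k _ => ?_
      rcases hy2 k with h | h
      · rw [← sub_mul, mul_pow, mul_comm]; gcongr
      · rw [h]; simp
    rw [div_pow, show (n : ℝ) * ((∑ k, (W l k * y k - w k * y k)) ^ 2 / (n : ℝ) ^ 2)
      = (∑ k, (W l k * y k - w k * y k)) ^ 2 / n by field_simp, div_le_iff₀ hn']
    nlinarith
  have h1 : pathMean p t (fun l => ∑ k, (acc l k - (∑ i, w i * y i) / n) ^ 2)
      ≤ pathMean p t fun l => dispersion (acc l) + S ^ 2 * ∑ k, (W l k - w k) ^ 2 :=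
    pathMean_mono hp.nonneg t fun l => by
      rw [sum_sq_sub_eq hn]; linarith [hmean l]
  rw [pathMean_add, pathMean_const_mul] at h1
  have h2 := mul_le_mul_of_nonneg_left (hWs t) (sq_nonneg S)
  refine (h1.trans (add_le_add (hdisp t) h2)).trans ?_
  have ht : (0 : ℝ) ≤ t := t.cast_nonneg
  have h0 : 0 ≤ r ^ t * S ^ 2 := by positivity
  have h00 : 0 ≤ D + (n * B * t + (t + 1)) := by positivity
  nlinarith [mul_nonneg h0 h00]

/-! ### The algorithm along a history -/

/-- The state reached along a history of edges, the most recent one first. -/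
def runList (mode : Schedule) (α : ℝ) (X : Fin n → ℝ) : List (Sym2 (Fin n)) → State n
  | [] => State.init X
  | x :: l => step mode α X (runList mode α X l) x

theorem run_eq_runList (mode : Schedule) (α : ℝ) (X : Fin n → ℝ) (e : ℕ → Sym2 (Fin n))
    (t : ℕ) : run mode α X e t = runList mode α X (history e t) := by
  induction t with
  | zero => rfl
  | succ t ih => simp only [run, history, runList, ih]

open Classical in
/-- The indicator that node `k` is refreshed when `x` is drawn. -/
def activity (mode : Schedule) (k : Fin n) (x : Sym2 (Fin n)) : ℝ :=
  if mode.Active x k then 1 else 0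

theorem activity_mem (mode : Schedule) (k : Fin n) (x : Sym2 (Fin n)) :
    0 ≤ activity mode k x ∧ activity mode k x ≤ 1 := by
  unfold activity; split_ifs <;> simp

/-- Every node is refreshed with positive probability. -/
theorem sum_activity_pos {G : SimpleGraph (Fin n)} {p : Sym2 (Fin n) → ℝ} (hn : 2 ≤ n)
    (hG : G.Connected) (hp : IsEdgeLaw G p) (mode : Schedule) (k : Fin n) :
    0 < ∑ x, p x * activity mode k x := by
  obtain ⟨j, hj⟩ : ∃ j, G.Adj k j := by
    have : Nontrivial (Fin n) := Fin.nontrivial_iff_two_le.2 hn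
    obtain ⟨j, hj⟩ := exists_ne k
    obtain ⟨w⟩ := hG.preconnected k j
    cases w with
    | nil => exact absurd rfl hj
    | cons h _ => exact ⟨_, h⟩
  refine Finset.sum_pos' (fun x _ => mul_nonneg (hp.nonneg x) (activity_mem mode k x).1)
    ⟨s(k, j), Finset.mem_univ _, mul_pos (hp.pos _ hj) ?_⟩
  cases mode <;> simp [activity, Schedule.Active]

theorem sum_activity_le_one {G : SimpleGraph (Fin n)} {p : Sym2 (Fin n) → ℝ}
    (hp : IsEdgeLaw G p) (mode : Schedule) (k : Fin n) : ∑ x, p x * activity mode k x ≤ 1 := by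
  rw [← hp.sum_eq_one]
  exact Finset.sum_le_sum fun x _ =>
    mul_le_of_le_one_right (hp.nonneg x) (activity_mem mode k x).2

/-- The indicator that node `j` holds an auxiliary observation below `X k`. -/
def below (X : Fin n → ℝ) (k : Fin n) (s : State n) (j : Fin n) : ℝ :=
  if s.aux j < X k then 1 else 0

theorem below_mem (X : Fin n → ℝ) (k : Fin n) (s : State n) (j : Fin n) :
    0 ≤ below X k s j ∧ below X k s j ≤ 1 := by
  unfold below; split_ifs <;> simp

section Run

variable (mode : Schedule) (α : ℝ) (X : Fin n → ℝ)

theorem below_runList_cons (k : Fin n) (x : Sym2 (Fin n)) (l : List (Sym2 (Fin n)))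
    (j : Fin n) : below X k (runList mode α X (x :: l)) j
      = below X k (runList mode α X l) (edgeSwap x j) := rfl

/-- Swaps only permute the auxiliary observations, so the number lying below `X k` is conserved. -/
theorem sum_below (k : Fin n) (l : List (Sym2 (Fin n))) :
    ∑ j, below X k (runList mode α X l) j = rank X k - 1 := by
  induction l with
  | nil =>
    change ∑ j, (if X j < X k then (1 : ℝ) else 0) = _
    rw [Finset.sum_boole, rank]
    push_cast; ring
  | cons x l ih => simp only [below_runList_cons, sum_comp_edgeSwap, ih]

theorem one_le_count (k : Fin n) (l : List (Sym2 (Fin n))) :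
    1 ≤ (runList mode α X l).count k := by
  induction l with
  | nil => exact le_rfl
  | cons x l ih =>
    simp only [runList, step]
    split_ifs <;> omega

theorem count_runList_cons (k : Fin n) (x : Sym2 (Fin n)) (l : List (Sym2 (Fin n))) :
    ((runList mode α X (x :: l)).count k : ℝ)
      = (runList mode α X l).count k + activity mode k x := by
  simp only [runList, step, activity]
  split_ifs <;> simp

/-- The recursive mean in additive form: `count - 1` is the number of observations made, and its
product with `normRank` is their running sum. -/
theorem normRank_runList_cons (k : Fin n) (x : Sym2 (Fin n)) (l : List (Sym2 (Fin n))) :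
    (((runList mode α X (x :: l)).count k : ℝ) - 1) * (runList mode α X (x :: l)).normRank k
      = ((runList mode α X l).count k - 1) * (runList mode α X l).normRank k
        + activity mode k x * below X k (runList mode α X l) k := by
  have h := one_le_count mode α X k l
  have h0 : ((runList mode α X l).count k : ℝ) ≠ 0 := by
    have : 0 < (runList mode α X l).count k := h
    positivity
  rw [count_runList_cons]
  simp only [runList, step, activity, below]
  by_cases ha : mode.Active x k
  · simp only [ha, if_true]; field_simp; ring
  · simp only [ha, if_false]; ring

/-- A node never refreshed keeps the initial weight `0`, which need not be the weight of its
estimated rank `1`; hence the first alternative. -/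
theorem wt_eq_weight (k : Fin n) (l : List (Sym2 (Fin n))) :
    (runList mode α X l).count k = 1 ∨ (runList mode α X l).wt k
      = weight n α (n * (runList mode α X l).normRank k + 1) := by
  induction l with
  | nil => exact Or.inl rfl
  | cons x l ih =>
    simp only [runList, step]
    by_cases ha : mode.Active x k
    · simp [ha]
    · simpa [ha] using ih

theorem num_runList_cons (x : Sym2 (Fin n)) (l : List (Sym2 (Fin n))) :
    (runList mode α X (x :: l)).num = average x fun k => (runList mode α X l).num k
      + ((runList mode α X (x :: l)).wt k - (runList mode α X l).wt k) * X k := rfl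

theorem mass_runList_cons (x : Sym2 (Fin n)) (l : List (Sym2 (Fin n))) :
    (runList mode α X (x :: l)).mass = average x fun k => (runList mode α X l).mass k
      + ((runList mode α X (x :: l)).wt k - (runList mode α X l).wt k) * 1 := by
  simp only [mul_one]; rfl

/-- The node of rank one never observes a smaller value. -/
theorem normRank_eq_zero {k : Fin n} (hk : rank X k = 1) (l : List (Sym2 (Fin n))) :
    (runList mode α X l).normRank k = 0 := by
  induction l with
  | nil => rfl
  | cons x l ih =>
    have h : ∀ j, below X k (runList mode α X l) j = 0 := by
      have h := sum_below mode α X k l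
      rw [hk, Nat.cast_one, sub_self, Finset.sum_eq_zero_iff_of_nonneg
        fun j _ => (below_mem X k _ j).1] at h
      exact fun j => h j (Finset.mem_univ j)
    have h2 := h k
    unfold below at h2
    simp only [runList, step, ih, h2]
    simp

end Run

/-! ### Weights -/

theorem two_mul_trimCount_lt {α : ℝ} (hn : 0 < n) (hα0 : 0 < α) (hα : α < 1 / 2) :
    2 * trimCount n α < n := by
  have hn' : (0 : ℝ) < n := by positivity
  have h : (trimCount n α : ℝ) ≤ α * n := Nat.floor_le (by positivity)
  have : ((2 * trimCount n α : ℕ) : ℝ) < n := by push_cast; nlinarith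
  exact_mod_cast this

theorem weight_mem {α : ℝ} (hn : 0 < n) (hα0 : 0 < α) (hα : α < 1 / 2) (x : ℝ) :
    0 ≤ weight n α x ∧ weight n α x ≤ n := by
  have hn' : (0 : ℝ) < n := by positivity
  have h : (2 * trimCount n α + 1 : ℝ) ≤ n := by exact_mod_cast two_mul_trimCount_lt hn hα0 hα
  have h1 : 1 / (n : ℝ) ≤ 1 - 2 * trimCount n α / n := by
    rw [div_le_iff₀ hn', sub_mul, div_mul_cancel₀ _ hn'.ne']; linarith
  have h2 : 0 < 1 - 2 * trimCount n α / (n : ℝ) := lt_of_lt_of_le (by positivity) h1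
  unfold weight
  split_ifs
  · refine ⟨by positivity, ?_⟩
    rw [div_le_iff₀ h2]
    calc (1 : ℝ) = n * (1 / n) := by field_simp
      _ ≤ _ := by gcongr
  · exact ⟨le_rfl, hn'.le⟩

/-- The interval ends are half-integers, so no end lies strictly within `1 / 2` of an integer. -/
theorem weight_of_abs_lt {α x : ℝ} {r : ℕ} (h : |x - r| < 1 / 2) : weight n α x
    = if trimCount n α + 1 ≤ r ∧ r + trimCount n α ≤ n
      then (1 : ℝ) / (1 - 2 * trimCount n α / n) else 0 := by
  obtain ⟨h1, h2⟩ := abs_lt.1 h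
  have key : x ∈ Set.Icc (leftEnd n α) (rightEnd n α) ↔
      trimCount n α + 1 ≤ r ∧ r + trimCount n α ≤ n := by
    simp only [Set.mem_Icc, leftEnd, rightEnd]
    constructor
    · rintro ⟨ha, hb⟩
      have ha' : (trimCount n α : ℝ) < r := by linarith
      have hb' : ((r + trimCount n α : ℕ) : ℝ) < (n + 1 : ℕ) := by push_cast; linarith
      exact ⟨by exact_mod_cast ha', Nat.lt_succ_iff.1 (Nat.cast_lt.1 hb')⟩
    · rintro ⟨ha, hb⟩
      have ha2 : ((trimCount n α + 1 : ℕ) : ℝ) ≤ r := by exact_mod_cast ha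
      have hb2 : ((r + trimCount n α : ℕ) : ℝ) ≤ n := by exact_mod_cast hb
      push_cast at ha2 hb2
      constructor <;> linarith
  unfold weight
  simp only [key]

theorem weight_natCast {α : ℝ} (r : ℕ) : weight n α r
    = if trimCount n α + 1 ≤ r ∧ r + trimCount n α ≤ n
      then (1 : ℝ) / (1 - 2 * trimCount n α / n) else 0 :=
  weight_of_abs_lt (by simp)

/-- The weight of an estimated rank within `1 / 2` of the integer `r` is the weight of `r`. -/
theorem weight_eq_of_abs_lt {α x : ℝ} {r : ℕ} (h : |x - r| < 1 / 2) :
    weight n α x = weight n α r := by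
  rw [weight_of_abs_lt h, weight_natCast]

theorem wt_mem (mode : Schedule) {α : ℝ} (X : Fin n → ℝ) (hn : 0 < n) (hα0 : 0 < α)
    (hα : α < 1 / 2) (k : Fin n) (l : List (Sym2 (Fin n))) :
    0 ≤ (runList mode α X l).wt k ∧ (runList mode α X l).wt k ≤ n := by
  induction l with
  | nil => exact ⟨le_rfl, n.cast_nonneg⟩
  | cons x l ih =>
    simp only [runList, step]
    by_cases ha : mode.Active x k
    · simpa only [ha, if_true] using weight_mem hn hα0 hα _
    · simpa only [ha, if_false] using ih

theorem rank_mem (X : Fin n → ℝ) (k : Fin n) : 1 ≤ rank X k ∧ rank X k ≤ n := by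
  refine ⟨by simp [rank], ?_⟩
  have h : (Finset.univ.filter fun l => X l < X k).card < (Finset.univ : Finset (Fin n)).card :=
    Finset.card_lt_card (Finset.filter_ssubset.2 ⟨k, Finset.mem_univ k, lt_irrefl _⟩)
  rw [Finset.card_univ, Fintype.card_fin] at h
  unfold rank; omega

theorem rank_injective {X : Fin n → ℝ} (hX : Function.Injective X) :
    Function.Injective (rank X) := by
  have key : ∀ i j, X i < X j → rank X i < rank X j := fun i j hij => by
    unfold rank
    refine Nat.add_lt_add_left (Finset.card_lt_card ?_) 1
    refine Finset.ssubset_iff_of_subset (fun l hl => ?_) |>.2 ⟨i, by simp [hij], by simp⟩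
    simp only [Finset.mem_filter, Finset.mem_univ, true_and] at hl ⊢
    exact hl.trans hij
  intro i j hij
  rcases lt_trichotomy (X i) (X j) with h | h | h
  · exact absurd hij (key i j h).ne
  · exact hX h
  · exact absurd hij (key j i h).ne'

theorem image_rank {X : Fin n → ℝ} (hX : Function.Injective X) :
    Finset.univ.image (rank X) = Finset.Icc 1 n := by
  refine Finset.eq_of_subset_of_card_le (fun r hr => ?_) ?_
  · obtain ⟨k, -, rfl⟩ := Finset.mem_image.1 hr
    exact Finset.mem_Icc.2 (rank_mem X k)
  · rw [Finset.card_image_of_injective _ (rank_injective hX)]; simp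

/-- The ranks run over `1, …, n`, and exactly `n - 2 m` of them carry the weight `n / (n - 2 m)`.
This makes `1` the limit of the masses. -/
theorem sum_weight_rank {α : ℝ} {X : Fin n → ℝ} (hn : 0 < n) (hα0 : 0 < α) (hα : α < 1 / 2)
    (hX : Function.Injective X) : ∑ k, weight n α (rank X k) = n := by
  have h1 : ∑ k, weight n α (rank X k) = ∑ r ∈ Finset.Icc 1 n, weight n α r := by
    rw [← image_rank hX, Finset.sum_image fun i _ j _ h => rank_injective hX h]
  have h2 := two_mul_trimCount_lt hn hα0 hα
  have h3 : (Finset.Icc 1 n).filter (fun r => trimCount n α + 1 ≤ r ∧ r + trimCount n α ≤ n)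
      = Finset.Icc (trimCount n α + 1) (n - trimCount n α) := by
    ext r; simp only [Finset.mem_filter, Finset.mem_Icc]; omega
  rw [h1]
  simp only [weight_natCast]
  rw [← Finset.sum_filter, h3, Finset.sum_const, Nat.card_Icc, nsmul_eq_mul]
  have h4 : ((n - trimCount n α + 1 - (trimCount n α + 1) : ℕ) : ℝ)
      = n - 2 * trimCount n α := by
    rw [show n - trimCount n α + 1 - (trimCount n α + 1) = n - 2 * trimCount n α by omega,
      Nat.cast_sub h2.le]
    push_cast; ring
  have h5 : (0 : ℝ) < n - 2 * trimCount n α := by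
    have : ((2 * trimCount n α : ℕ) : ℝ) < n := by exact_mod_cast h2
    push_cast at this; linarith
  have hn' : (n : ℝ) ≠ 0 := by positivity
  rw [h4, show 1 - 2 * trimCount n α / (n : ℝ) = (n - 2 * trimCount n α) / n by field_simp]
  field_simp

theorem trimmedMean_eq {α : ℝ} (X : Fin n → ℝ) (hn : 0 < n) (hα0 : 0 < α) (hα : α < 1 / 2) :
    trimmedMean α X = (∑ k, weight n α (rank X k) * X k) / n := by
  have h5 : (0 : ℝ) < n - 2 * trimCount n α := by
    have : ((2 * trimCount n α : ℕ) : ℝ) < n := by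
      exact_mod_cast two_mul_trimCount_lt hn hα0 hα
    push_cast at this; linarith
  have hn' : (n : ℝ) ≠ 0 := by positivity
  unfold trimmedMean
  rw [Finset.sum_div]
  refine Finset.sum_congr rfl fun k _ => ?_
  rw [weight_natCast, show 1 - 2 * trimCount n α / (n : ℝ) = (n - 2 * trimCount n α) / n by
    field_simp]
  split_ifs
  · field_simp
  · simp

/-! ### Concentration of the rank estimates -/

/-- From `exp u ≤ 1 + u + u ^ 2` for `|u| ≤ 1`: for small `θ` the negative drift beats the quadratic
term. -/
theorem sum_mul_exp_le {p : Sym2 (Fin n) → ℝ} (hp : ∀ e, 0 ≤ p e) (hp1 : ∑ e, p e = 1)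
    {Δ : Sym2 (Fin n) → ℝ} {B θ d : ℝ} (hB : ∀ x, |Δ x| ≤ B) (hθ : 0 ≤ θ) (hθB : θ * B ≤ 1)
    (hd : ∑ x, p x * Δ x ≤ -d) :
    ∑ x, p x * Real.exp (θ * Δ x) ≤ 1 - θ * d + θ ^ 2 * B ^ 2 := by
  have h : ∀ x, p x * Real.exp (θ * Δ x)
      ≤ p x * (1 + θ ^ 2 * B ^ 2) + θ * (p x * Δ x) := fun x => by
    have h1 : |θ * Δ x| ≤ θ * B := by
      rw [abs_mul, abs_of_nonneg hθ]; exact mul_le_mul_of_nonneg_left (hB x) hθ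
    have h2 := (abs_le.1 (Real.abs_exp_sub_one_sub_id_le (h1.trans hθB))).2
    have h3 : (θ * Δ x) ^ 2 ≤ θ ^ 2 * B ^ 2 := by
      rw [← sq_abs, ← mul_pow]; exact pow_le_pow_left₀ (abs_nonneg _) h1 2
    have h4 : Real.exp (θ * Δ x) ≤ 1 + θ ^ 2 * B ^ 2 + θ * Δ x := by linarith
    calc _ ≤ p x * (1 + θ ^ 2 * B ^ 2 + θ * Δ x) := mul_le_mul_of_nonneg_left h4 (hp x)
      _ = _ := by ring
  have h5 := Finset.sum_le_sum fun x (_ : x ∈ Finset.univ) => h x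
  rw [Finset.sum_add_distrib, ← Finset.sum_mul, ← Finset.mul_sum, hp1] at h5
  nlinarith [mul_le_mul_of_nonneg_left hd hθ]

/-- The signed excess of the accumulated rank error of node `k` over its tolerance. -/
def excess (mode : Schedule) (α : ℝ) (X : Fin n → ℝ) (k : Fin n) (ε : ℝ)
    (l : List (Sym2 (Fin n))) : ℝ :=
  (((runList mode α X l).count k : ℝ) - 1)
    * (ε * ((runList mode α X l).normRank k - (rank X k - 1) / n) - 1 / (2 * n))

theorem excess_cons (mode : Schedule) (α : ℝ) (X : Fin n → ℝ) (k : Fin n) (ε : ℝ)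
    (x : Sym2 (Fin n)) (l : List (Sym2 (Fin n))) :
    excess mode α X k ε (x :: l) = excess mode α X k ε l + activity mode k x
      * (ε * (below X k (runList mode α X l) k - (rank X k - 1) / n) - 1 / (2 * n)) := by
  have h1 := count_runList_cons mode α X k x l
  have h2 := normRank_runList_cons mode α X k x l
  unfold excess
  rw [h1] at h2 ⊢
  linear_combination ε * h2

/-- A wrong weight forces a nonnegative excess of one sign. -/
theorem sq_wt_sub_le {mode : Schedule} {α : ℝ} {X : Fin n → ℝ} (hn : 0 < n) (hα0 : 0 < α)
    (hα : α < 1 / 2) {θ : ℝ} (hθ : 0 ≤ θ) (k : Fin n) (l : List (Sym2 (Fin n))) :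
    ((runList mode α X l).wt k - weight n α (rank X k)) ^ 2
      ≤ (n : ℝ) ^ 2 * (Real.exp (θ * excess mode α X k 1 l)
        + Real.exp (θ * excess mode α X k (-1) l)) := by
  have hn' : (0 : ℝ) < n := by positivity
  by_cases hw : (runList mode α X l).wt k = weight n α (rank X k)
  · rw [hw, sub_self, zero_pow two_ne_zero]; positivity
  have hc : (0 : ℝ) ≤ ((runList mode α X l).count k : ℝ) - 1 := by
    have : (1 : ℝ) ≤ (runList mode α X l).count k := by
      exact_mod_cast one_le_count mode α X k l
    linarith
  have hwt := wt_mem mode X hn hα0 hα k l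
  have hws := weight_mem hn hα0 hα (rank X k)
  have hsq : ((runList mode α X l).wt k - weight n α (rank X k)) ^ 2 ≤ (n : ℝ) ^ 2 * 1 := by
    rw [mul_one]; exact sq_le_sq' (by linarith) (by linarith)
  have hex : ∀ ε, 0 ≤ excess mode α X k ε l → 1 ≤ Real.exp (θ * excess mode α X k ε l) :=
    fun ε h => Real.one_le_exp (mul_nonneg hθ h)
  refine hsq.trans (mul_le_mul_of_nonneg_left ?_ (by positivity))
  rcases wt_eq_weight mode α X k l with h1 | h1
  -- Before the first refreshment the excess is zero, so its exponential already accounts for the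
  -- initial weight.
  · have : 1 ≤ Real.exp (θ * excess mode α X k 1 l) := hex 1 (by simp [excess, h1])
    linarith [Real.exp_pos (θ * excess mode α X k (-1) l)]
  · have h2 : 1 / 2 ≤ |(n * (runList mode α X l).normRank k + 1) - rank X k| := by
      by_contra! h
      exact hw (h1.trans (weight_eq_of_abs_lt h))
    have h3 : (n * (runList mode α X l).normRank k + 1) - rank X k
        = n * ((runList mode α X l).normRank k - (rank X k - 1) / n) := by field_simp; ring
    rw [h3, abs_mul, abs_of_pos hn', ← div_le_iff₀' hn', div_div] at h2
    rcases le_abs.1 h2 with h | h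
    · have := hex 1 (mul_nonneg hc (by linarith))
      linarith [Real.exp_pos (θ * excess mode α X k (-1) l)]
    · have := hex (-1) (mul_nonneg hc (by linarith))
      linarith [Real.exp_pos (θ * excess mode α X k 1 l)]

/-- The weights of the algorithm approach those of the true ranks geometrically fast in mean
square, uniformly in the data. -/
theorem exists_weight_bound {G : SimpleGraph (Fin n)} {p : Sym2 (Fin n) → ℝ} (hn : 2 ≤ n)
    (hG : G.Connected) (hp : IsEdgeLaw G p) (mode : Schedule) :
    ∃ B ρ : ℝ, 0 ≤ B ∧ 0 ≤ ρ ∧ ρ < 1 ∧ ∀ (α : ℝ) (X : Fin n → ℝ), 0 < α → α < 1 / 2 →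
      ∀ t k, pathMean p t
        (fun l => ((runList mode α X l).wt k - weight n α (rank X k)) ^ 2) ≤ B * ρ ^ t := by
  have hn0 : 0 < n := by omega
  have hn' : (0 : ℝ) < n := by positivity
  have hn2 : (2 : ℝ) ≤ n := by exact_mod_cast hn
  choose v hv using exists_poisson hG hp
  have : Nonempty (Fin n) := ⟨⟨0, hn0⟩⟩
  -- The least active node gives a drift bound valid for all nodes.
  obtain ⟨k₀, -, hk₀⟩ := Finset.exists_min_image (Finset.univ : Finset (Fin n))
    (fun k => ∑ x, p x * activity mode k x) Finset.univ_nonempty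
  set π₀ := ∑ x, p x * activity mode k₀ x with hπ₀
  have hπpos : 0 < π₀ := sum_activity_pos hn hG hp mode k₀
  have hπ1 : π₀ ≤ 1 := sum_activity_le_one hp mode k₀
  set U := ∑ k, ∑ j, |v k j| with hU
  have hU0 : 0 ≤ U := Finset.sum_nonneg fun _ _ => Finset.sum_nonneg fun _ _ => abs_nonneg _
  have hUk : ∀ k, ∑ j, |v k j| ≤ U := fun k =>
    Finset.single_le_sum (f := fun k => ∑ j, |v k j|)
      (fun _ _ => Finset.sum_nonneg fun _ _ => abs_nonneg _) (Finset.mem_univ k)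
  set b := 2 + U with hb
  set d := π₀ / (2 * n) with hd
  have hd0 : 0 < d := by positivity
  have hd1 : d ≤ 1 := by rw [hd, div_le_iff₀ (by positivity)]; linarith
  -- This minimizes `1 - θ d + θ ^ 2 b ^ 2`, leaving `1 - θ d / 2`.
  set θ := d / (2 * b ^ 2) with hθ
  have hb0 : 0 < b := by positivity
  have hθ0 : 0 < θ := by positivity
  have hθb2 : θ * b ^ 2 = d / 2 := by rw [hθ]; field_simp
  have hθb : θ * b ≤ 1 := by nlinarith
  have hθU : θ * U ≤ 1 := le_trans (mul_le_mul_of_nonneg_left (by linarith) hθ0.le) hθb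
  set ρ := 1 - θ * d + θ ^ 2 * b ^ 2 with hρ
  have hρ' : ρ = 1 - θ * d / 2 := by
    rw [hρ, sq θ, mul_assoc, hθb2]; ring
  have hθ1 : θ ≤ 1 := by nlinarith
  have hρ0 : 0 ≤ ρ := by rw [hρ']; nlinarith
  have hρ1 : ρ < 1 := by rw [hρ']; nlinarith [mul_pos hθ0 hd0]
  -- The factor `2` counts the two signs of the error; `exp 2` pays for the corrector once initially
  -- and once when it is removed.
  refine ⟨2 * n ^ 2 * Real.exp 2, ρ, by positivity, hρ0, hρ1, fun α X hα0 hα t k => ?_⟩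
  set π := ∑ x, p x * activity mode k x with hπ
  have hππ : π₀ ≤ π := hk₀ k (Finset.mem_univ k)
  have hπk : π ≤ 1 := sum_activity_le_one hp mode k
  have hq0 : 0 ≤ ((rank X k : ℝ) - 1) / n ∧ ((rank X k : ℝ) - 1) / n ≤ 1 := by
    have h1 : (1 : ℝ) ≤ rank X k := by exact_mod_cast (rank_mem X k).1
    have h2 : (rank X k : ℝ) ≤ n := by exact_mod_cast (rank_mem X k).2
    exact ⟨div_nonneg (by linarith) hn'.le, by rw [div_le_one hn']; linarith⟩
  have h2n : 0 < 1 / (2 * (n : ℝ)) ∧ 1 / (2 * (n : ℝ)) ≤ 1 := by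
    refine ⟨by positivity, ?_⟩
    rw [div_le_one (by positivity)]; linarith
  let h : List (Sym2 (Fin n)) → Fin n → ℝ := fun l => below X k (runList mode α X l)
  let corr : List (Sym2 (Fin n)) → ℝ := fun l => ∑ j, v k j * h l j
  have hcorr : ∀ l, |corr l| ≤ U := fun l => by
    refine (Finset.abs_sum_le_sum_abs _ _).trans (le_trans ?_ (hUk k))
    refine Finset.sum_le_sum fun j _ => ?_
    have := below_mem X k (runList mode α X l) j
    rw [abs_mul, abs_of_nonneg this.1]
    exact mul_le_of_le_one_right (abs_nonneg _) this.2
  have hcorr2 : ∀ x l, |corr (x :: l) - corr l| ≤ U := fun x l => by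
    simp only [corr, ← Finset.sum_sub_distrib, ← mul_sub]
    refine (Finset.abs_sum_le_sum_abs _ _).trans (le_trans ?_ (hUk k))
    refine Finset.sum_le_sum fun j _ => ?_
    have h1 := below_mem X k (runList mode α X l) j
    have h2 := below_mem X k (runList mode α X (x :: l)) j
    rw [abs_mul]
    exact mul_le_of_le_one_right (abs_nonneg _) (abs_le.2 ⟨by linarith, by linarith⟩)
  have hpoisson : ∀ l, ∑ x, p x * (corr (x :: l) - corr l)
      = -(h l k - ((rank X k : ℝ) - 1) / n) := fun l => by
    have e1 : ∑ j, (weightedLaplacian p).mulVec (v k) j * h l j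
        = h l k - ((rank X k : ℝ) - 1) / n := by
      simp only [hv, sub_mul, Finset.sum_sub_distrib, ← Finset.mul_sum, h, sum_below]
      simp [Pi.single_apply]; ring
    have e2 : dirichlet p (v k) (h l) = dirichlet p (h l) (v k) := by
      simp only [dirichlet]
      exact Finset.sum_congr rfl fun _ _ => Finset.sum_congr rfl fun _ _ => by ring
    rw [← e1, sum_mulVec_mul, e2, ← sum_mulVec_mul]
    simp only [weightedLaplacian_mulVec, corr, h, below_runList_cons, Finset.sum_mul,
      ← Finset.sum_sub_distrib, Finset.mul_sum]
    rw [Finset.sum_comm, ← Finset.sum_neg_distrib]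
    refine Finset.sum_congr rfl fun _ _ => ?_
    rw [← Finset.sum_neg_distrib]
    exact Finset.sum_congr rfl fun _ _ => by ring
  have main : ∀ ε : ℝ, |ε| = 1 → pathMean p t (fun l => Real.exp (θ * excess mode α X k ε l))
      ≤ Real.exp 2 * ρ ^ t := fun ε hε => by
    -- The mean increment of the corrector cancels the deviation of the current observation,
    -- weighted by the activity `π`. Only the drift `-π / (2 n)` from the tolerance survives, and
    -- the dependence between refreshment and swap plays no role.
    let Φ : List (Sym2 (Fin n)) → ℝ := fun l => excess mode α X k ε l + ε * π * corr l
    have hεc : ∀ l, |ε * π * corr l| ≤ U := fun l => by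
      rw [abs_mul, abs_mul, hε, one_mul, abs_of_pos (hπpos.trans_le hππ)]
      exact (mul_le_of_le_one_left (abs_nonneg _) hπk).trans (hcorr l)
    have hΦ0 : Real.exp (θ * Φ []) ≤ Real.exp 1 := by
      refine Real.exp_le_exp.2 ?_
      have : Φ [] = ε * π * corr [] := by simp [Φ, excess, runList, State.init]
      rw [this]
      exact (mul_le_mul_of_nonneg_left ((le_abs_self _).trans (hεc [])) hθ0.le).trans hθU
    have hstep : ∀ l, ∑ x, p x * Real.exp (θ * Φ (x :: l)) ≤ ρ * Real.exp (θ * Φ l) := fun l => by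
      let Δ : Sym2 (Fin n) → ℝ := fun x => activity mode k x
        * (ε * (h l k - (rank X k - 1) / n) - 1 / (2 * n)) + ε * π * (corr (x :: l) - corr l)
      have hΔ : ∀ x, Φ (x :: l) = Φ l + Δ x := fun x => by
        simp only [Φ, Δ, excess_cons, h]; ring
      have hbound : ∀ x, |Δ x| ≤ b := fun x => by
        have ha := activity_mem mode k x
        have hh := below_mem X k (runList mode α X l) k
        have g1 : |ε * (h l k - (rank X k - 1) / n) - 1 / (2 * n)| ≤ 2 := by
          refine (abs_sub _ _).trans ?_
          have : |h l k - (rank X k - 1) / n| ≤ 1 := abs_le.2 ⟨by linarith, by linarith⟩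
          rw [abs_mul, hε, one_mul, abs_of_pos h2n.1]
          linarith
        refine (abs_add_le _ _).trans (add_le_add ?_ ?_)
        · rw [abs_mul, abs_of_nonneg ha.1]
          exact (mul_le_of_le_one_left (abs_nonneg _) ha.2).trans g1
        · rw [abs_mul, abs_mul, hε, one_mul, abs_of_pos (hπpos.trans_le hππ)]
          exact (mul_le_of_le_one_left (abs_nonneg _) hπk).trans (hcorr2 x l)
      have hdrift : ∑ x, p x * Δ x ≤ -d := by
        have : ∑ x, p x * Δ x = π * (ε * (h l k - (rank X k - 1) / n) - 1 / (2 * n))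
            + ε * π * ∑ x, p x * (corr (x :: l) - corr l) := by
          rw [hπ, Finset.sum_mul, Finset.mul_sum, ← Finset.sum_add_distrib]
          exact Finset.sum_congr rfl fun x _ => by simp only [Δ]; ring
        rw [this, hpoisson]
        have h6 : d ≤ π / (2 * n) := by rw [hd]; gcongr
        have h7 : π * (1 / (2 * n)) = π / (2 * n) := by ring
        nlinarith
      have h5 := sum_mul_exp_le hp.nonneg hp.sum_eq_one hbound hθ0.le hθb hdrift
      calc ∑ x, p x * Real.exp (θ * Φ (x :: l))
          = Real.exp (θ * Φ l) * ∑ x, p x * Real.exp (θ * Δ x) := by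
            rw [Finset.mul_sum]
            refine Finset.sum_congr rfl fun x _ => ?_
            rw [hΔ, mul_add, Real.exp_add]; ring
        _ ≤ Real.exp (θ * Φ l) * ρ := mul_le_mul_of_nonneg_left h5 (Real.exp_pos _).le
        _ = _ := mul_comm _ _
    have h6 := pathMean_le_pow (F := fun l => Real.exp (θ * Φ l)) hp.nonneg hρ0 hstep t
    calc pathMean p t (fun l => Real.exp (θ * excess mode α X k ε l))
        ≤ pathMean p t (fun l => Real.exp 1 * Real.exp (θ * Φ l)) := by
          refine pathMean_mono hp.nonneg t fun l => ?_
          rw [← Real.exp_add]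
          refine Real.exp_le_exp.2 ?_
          have h7 := (abs_le.1 (hεc l)).1
          simp only [Φ]
          nlinarith
      _ = Real.exp 1 * pathMean p t (fun l => Real.exp (θ * Φ l)) := pathMean_const_mul ..
      _ ≤ Real.exp 1 * (ρ ^ t * Real.exp 1) := by
          refine mul_le_mul_of_nonneg_left (h6.trans ?_) (Real.exp_pos _).le
          exact mul_le_mul_of_nonneg_left hΦ0 (by positivity)
      _ = Real.exp 2 * ρ ^ t := by
          rw [show (2 : ℝ) = 1 + 1 by norm_num, Real.exp_add]; ring
  refine (pathMean_mono hp.nonneg t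
    fun l => sq_wt_sub_le hn0 hα0 hα hθ0.le k l).trans ?_
  rw [pathMean_const_mul, pathMean_add]
  have h1 := main 1 (by simp)
  have h2 := main (-1) (by simp)
  calc _ ≤ (n : ℝ) ^ 2 * (Real.exp 2 * ρ ^ t + Real.exp 2 * ρ ^ t) := by gcongr
    _ = _ := by ring

/-! ### The error of the estimate -/

theorem l2norm_sq (v : Fin n → ℝ) : l2norm v ^ 2 = ∑ k, v k ^ 2 := by
  simp [l2norm, EuclideanSpace.real_norm_sq_eq]

theorem l2norm_nonneg (v : Fin n → ℝ) : 0 ≤ l2norm v := norm_nonneg _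

theorem abs_le_l2norm (v : Fin n → ℝ) (k : Fin n) : |v k| ≤ l2norm v := by
  refine abs_le_of_sq_le_sq ?_ (l2norm_nonneg v)
  rw [l2norm_sq]
  exact Finset.single_le_sum (f := fun k => v k ^ 2) (fun _ _ => sq_nonneg _) (Finset.mem_univ k)

/-- Clipping at `1` never moves `M` farther from `1`, and a denominator at least `1` only shrinks
the error. -/
theorem sq_div_max_sub_le (N M z : ℝ) :
    (N / max 1 M - z) ^ 2 ≤ 2 * (N - z) ^ 2 + 2 * z ^ 2 * (M - 1) ^ 2 := by
  set D := max 1 M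
  have hD : 1 ≤ D := le_max_left _ _
  have h1 : (D - 1) ^ 2 ≤ (M - 1) ^ 2 := by
    rcases le_total 1 M with h | h
    · rw [show D = M from max_eq_right h]
    · rw [show D = 1 from max_eq_left h]; simpa using sq_nonneg (M - 1)
  have h2 : N / D - z = ((N - z) - z * (D - 1)) / D := by field_simp; ring
  rw [h2, div_pow]
  have h3 : ((N - z) - z * (D - 1)) ^ 2 / D ^ 2 ≤ ((N - z) - z * (D - 1)) ^ 2 :=
    div_le_self (sq_nonneg _) (one_le_pow₀ hD)
  have h4 := mul_le_mul_of_nonneg_left h1 (sq_nonneg z)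
  nlinarith [sq_nonneg ((N - z) + z * (D - 1))]

/-- A trimmed node of rank one always has the right weight. -/
theorem wt_eq_weight_of_trimmed (mode : Schedule) {α : ℝ} (X : Fin n → ℝ) {k : Fin n}
    (hk : rank X k = 1) (hm : 1 ≤ trimCount n α) (l : List (Sym2 (Fin n))) :
    (runList mode α X l).wt k = weight n α (rank X k) := by
  have h0 : weight n α (rank X k) = 0 := by
    rw [weight_natCast, if_neg (by rw [hk]; omega)]
  have h1 := normRank_eq_zero mode α X hk
  rw [h0]
  induction l with
  | nil => rfl
  | cons x l ih =>
    by_cases ha : mode.Active x k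
    · have h2 : (runList mode α X (x :: l)).wt k
          = weight n α (n * (runList mode α X (x :: l)).normRank k + 1) := by
        simp only [runList, step, ha, if_true]
      rw [h2, h1, mul_zero, zero_add, ← h0, hk, Nat.cast_one]
    · simpa only [runList, step, ha, if_false] using ih

/-- The mean error of Adaptive GoTrim decays geometrically, up to a linear factor, at a rate
that does not depend on the data. Observations of rank one may be ignored if they are trimmed. -/
theorem exists_error_bound {G : SimpleGraph (Fin n)} {p : Sym2 (Fin n) → ℝ} (hn : 2 ≤ n)
    (hG : G.Connected) (hp : IsEdgeLaw G p) (mode : Schedule) :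
    ∃ K r : ℝ, 0 < K ∧ 0 < r ∧ r < 1 ∧ ∀ (α : ℝ) (X : Fin n → ℝ) (S : ℝ), 0 < α → α < 1 / 2 →
      Function.Injective X → 0 < S → |trimmedMean α X| ≤ S →
      (∀ k, |X k| ≤ S ∨ rank X k = 1 ∧ 1 ≤ trimCount n α) →
      ∀ t : ℕ, pathMean p t (fun l => l2norm fun k =>
          (runList mode α X l).num k / max 1 ((runList mode α X l).mass k) - trimmedMean α X)
        ≤ √(K * (t + 1) * r ^ t) * S := by
  have hn0 : 0 < n := by omega
  have hn' : (n : ℝ) ≠ 0 := by positivity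
  obtain ⟨B, ρ, hB, hρ0, hρ1, hW⟩ := exists_weight_bound hn hG hp mode
  obtain ⟨K, r, hK, hr0, hr1, hacc⟩ := exists_accumulator_bound hn0 hG hp hB hρ0 hρ1
  refine ⟨4 * K, r, by positivity, hr0, hr1, fun α X S hα0 hα hX hS hz hXS t => ?_⟩
  set z := trimmedMean α X with hzdef
  let R := runList mode α X
  have hN := hacc (fun l => (R l).wt) (fun l => (R l).num) (fun k => weight n α (rank X k)) X S
    (fun _ => rfl) (fun _ => rfl) (num_runList_cons mode α X) (hW α X hα0 hα)
    (fun k => (hXS k).imp_right fun hk => wt_eq_weight_of_trimmed mode X hk.1 hk.2) t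
  -- The masses are the accumulators of the constant data `1`, with scale `1`.
  have hM := hacc (fun l => (R l).wt) (fun l => (R l).mass) (fun k => weight n α (rank X k))
    (fun _ => 1) 1 (fun _ => rfl) (fun _ => rfl) (mass_runList_cons mode α X) (hW α X hα0 hα)
    (fun k => Or.inl (by simp)) t
  simp only [mul_one, one_pow, sum_weight_rank hn0 hα0 hα hX, div_self hn'] at hM
  rw [← trimmedMean_eq X hn0 hα0 hα] at hN
  have hq : 0 < 4 * K * (t + 1) * r ^ t := by positivity
  refine pathMean_le_of_sq_le hp.nonneg hp.sum_eq_one t (by positivity) ?_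
  rw [mul_pow, Real.sq_sqrt hq.le]
  calc _ ≤ pathMean p t (fun l => 2 * ∑ k, ((R l).num k - z) ^ 2
        + 2 * z ^ 2 * ∑ k, ((R l).mass k - 1) ^ 2) := by
        refine pathMean_mono hp.nonneg t fun l => ?_
        rw [l2norm_sq, Finset.mul_sum, Finset.mul_sum, ← Finset.sum_add_distrib]
        exact Finset.sum_le_sum fun k _ => sq_div_max_sub_le _ _ _
    _ = 2 * pathMean p t (fun l => ∑ k, ((R l).num k - z) ^ 2)
        + 2 * z ^ 2 * pathMean p t (fun l => ∑ k, ((R l).mass k - 1) ^ 2) := by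
        rw [pathMean_add, pathMean_const_mul, pathMean_const_mul]
    _ ≤ 2 * (K * (t + 1) * r ^ t * S ^ 2) + 2 * S ^ 2 * (K * (t + 1) * r ^ t) := by
        have hz2 : z ^ 2 ≤ S ^ 2 := by
          rw [← sq_abs]; exact pow_le_pow_left₀ (abs_nonneg _) hz 2
        have h0 : 0 ≤ K * (t + 1) * r ^ t := by positivity
        refine add_le_add (mul_le_mul_of_nonneg_left hN zero_le_two) ?_
        exact (mul_le_mul_of_nonneg_left hM (by positivity)).trans
          (mul_le_mul_of_nonneg_right (by linarith) h0)
    _ = _ := by ring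

/-- Geometric decay beats the polynomial factor `t (t + 1)`. The threshold depends on the data only
through `A`. -/
theorem exists_forall_lt_le {K r c d : ℝ} (A : ℝ) (hr0 : 0 < r) (hr1 : r < 1)
    (hc : 0 < c) (hd : 0 < d) :
    ∃ T : ℝ, 0 < T ∧ ∀ t : ℕ, T < t → √(K * (t + 1) * r ^ t) * A ≤ 1 / (d * √(c * t)) := by
  have h1 : Filter.Tendsto (fun t : ℕ => √(c * t) * √(K * (t + 1) * r ^ t) * (A * d))
      Filter.atTop (nhds 0) := by
    have habs : |r| < 1 := by rwa [abs_of_pos hr0]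
    have h2 := tendsto_pow_const_mul_const_pow_of_abs_lt_one 2 habs
    have h3 := tendsto_pow_const_mul_const_pow_of_abs_lt_one 1 habs
    have h4 := ((h2.add h3).const_mul (c * K)).sqrt.mul_const (A * d)
    simp only [add_zero, mul_zero, Real.sqrt_zero, zero_mul] at h4
    refine h4.congr fun t => ?_
    rw [← Real.sqrt_mul (by positivity)]
    congr 2; ring
  obtain ⟨N, hN⟩ := Filter.eventually_atTop.1 (h1.eventually (gt_mem_nhds one_pos))
  refine ⟨N + 1, by positivity, fun t ht => ?_⟩
  have ht0 : (0 : ℝ) < t := lt_trans (by positivity) ht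
  have htN : N ≤ t := by
    have : (N : ℝ) ≤ t := by linarith
    exact_mod_cast this
  have hs : 0 < √(c * t) := by positivity
  rw [le_div_iff₀ (by positivity)]
  have := hN t htN
  nlinarith

/-! ### Lower bounds for the vector `K` -/

/-- Here `σ ≥ 1`, `γ ≤ n` and `1 - 2 α ≤ 1`. Rank one is excluded because `σ` vanishes there. -/
theorem one_div_le_kVec {α : ℝ} (X : Fin n → ℝ) (hα0 : 0 < α) (hα : α < 1 / 2) {k : Fin n}
    (hk : 2 ≤ rank X k) : 1 / (n : ℝ) ≤ kVec α X k := by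
  have hn : 0 < n := k.pos
  have hn' : (0 : ℝ) < n := by positivity
  have hn1 : (1 : ℝ) ≤ n := by exact_mod_cast hn
  have hr2 : (2 : ℝ) ≤ rank X k := by exact_mod_cast hk
  have hrn : (rank X k : ℝ) ≤ n := by exact_mod_cast (rank_mem X k).2
  have hm : (2 * trimCount n α + 1 : ℝ) ≤ n := by exact_mod_cast two_mul_trimCount_lt hn hα0 hα
  have hm0 : (0 : ℝ) ≤ trimCount n α := Nat.cast_nonneg _
  -- An integer is never a half-integer, so `gamma` is positive and the quotient is not the default
  -- value `0`.
  have hhalf : ∀ i j : ℤ, (0 : ℝ) < |(i : ℝ) - (j + 1 / 2)| := fun i j => by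
    refine abs_pos.2 fun h => ?_
    have h2 : ((2 * i : ℤ) : ℝ) = ((2 * j + 1 : ℤ) : ℝ) := by push_cast; linarith
    have h3 : 2 * i = 2 * j + 1 := by exact_mod_cast h2
    omega
  have hγ0 : 0 < gamma α X k := by
    refine lt_min ?_ ?_
    · simpa [leftEnd] using hhalf (rank X k) (trimCount n α)
    · simpa [rightEnd] using hhalf (rank X k) (n - trimCount n α)
  have hγn : gamma α X k ≤ n := by
    refine (min_le_left _ _).trans (abs_le.2 ⟨?_, ?_⟩) <;> unfold leftEnd <;> linarith
  have hσ : 1 ≤ sigma n (rank X k) := by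
    have h1 : (1 / (n : ℝ)) ≤ √((rank X k - 1) / n * (1 - (rank X k - 1) / n)) := by
      refine Real.le_sqrt_of_sq_le ?_
      have e1 : 1 / (n : ℝ) ≤ (rank X k - 1) / n := by gcongr; linarith
      have e2 : 1 / (n : ℝ) ≤ 1 - (rank X k - 1) / n := by
        rw [div_le_iff₀ hn', sub_mul, div_mul_cancel₀ _ hn'.ne']; linarith
      rw [sq]
      exact mul_le_mul e1 e2 (by positivity) (le_trans (by positivity) e1)
    have h2 : (n : ℝ) ≤ (n : ℝ) ^ (3 / 2 : ℝ) := by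
      calc (n : ℝ) = (n : ℝ) ^ (1 : ℝ) := (Real.rpow_one _).symm
        _ ≤ _ := Real.rpow_le_rpow_of_exponent_le hn1 (by norm_num)
    calc (1 : ℝ) = n * (1 / n) := by field_simp
      _ ≤ _ := mul_le_mul h2 h1 (by positivity) (by positivity)
  have h6 : (1 : ℝ) ≤ √6 := Real.one_le_sqrt.2 (by norm_num)
  have hα1 : 0 < 1 - 2 * α := by linarith
  unfold kVec
  refine div_le_div₀ (by positivity) ?_ (by positivity) ?_
  · nlinarith
  · nlinarith

theorem exists_rank_eq {X : Fin n → ℝ} (hX : Function.Injective X) {r : ℕ} (h1 : 1 ≤ r)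
    (hr : r ≤ n) : ∃ k, rank X k = r := by
  have : r ∈ Finset.univ.image (rank X) := by
    rw [image_rank hX]; exact Finset.mem_Icc.2 ⟨h1, hr⟩
  obtain ⟨k, -, hk⟩ := Finset.mem_image.1 this
  exact ⟨k, hk⟩

theorem l2norm_kVec_mul_pos {α : ℝ} {X : Fin n → ℝ} (hα0 : 0 < α) (hα : α < 1 / 2)
    {y : Fin n → ℝ} {k : Fin n} (hk : 2 ≤ rank X k) (hy : y k ≠ 0) :
    0 < l2norm fun k => kVec α X k * y k := by
  have hn' : (0 : ℝ) < n := by exact_mod_cast k.pos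
  have h0 : 0 < kVec α X k := lt_of_lt_of_le (by positivity) (one_div_le_kVec X hα0 hα hk)
  exact lt_of_lt_of_le (abs_pos.2 (mul_ne_zero h0.ne' hy))
    (abs_le_l2norm (fun k => kVec α X k * y k) k)

theorem exists_two_le_rank_ne {X : Fin n → ℝ} (hn : 3 ≤ n) (hX : Function.Injective X)
    (z : ℝ) : ∃ k, 2 ≤ rank X k ∧ X k ≠ z := by
  obtain ⟨i, hi⟩ := exists_rank_eq hX (r := 2) (by norm_num) (by omega)
  obtain ⟨j, hj⟩ := exists_rank_eq hX (r := 3) (by norm_num) hn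
  by_cases h : X i = z
  · refine ⟨j, by omega, fun h2 => ?_⟩
    rw [hX (h.trans h2.symm)] at hi
    omega
  · exact ⟨i, hi.ge, h⟩

/-- The right-hand side controls the trimmed mean and every observation, except a trimmed
observation of rank one. -/
theorem scale_le {α : ℝ} {X : Fin n → ℝ} (hn : 2 ≤ n) (hα0 : 0 < α) (hα : α < 1 / 2)
    (hX : Function.Injective X) {S : ℝ}
    (hS : S = l2norm fun k => kVec α X k * (|X k| + |trimmedMean α X|)) :
    |trimmedMean α X| ≤ 2 * n ^ 2 * S ∧
      ∀ k, |X k| ≤ 2 * n ^ 2 * S ∨ rank X k = 1 ∧ 1 ≤ trimCount n α := by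
  have hn0 : 0 < n := by omega
  have hn' : (0 : ℝ) < n := by positivity
  have hn1 : (1 : ℝ) ≤ n := by exact_mod_cast hn0
  have hS0 : 0 ≤ S := hS ▸ l2norm_nonneg _
  set z := trimmedMean α X with hz
  have h1 : ∀ k, 2 ≤ rank X k → |X k| + |z| ≤ n * S := fun k hk => by
    have h2 := abs_le_l2norm (fun k => kVec α X k * (|X k| + |z|)) k
    rw [← hS, abs_mul, abs_of_nonneg (by positivity : 0 ≤ |X k| + |z|)] at h2
    have h3 := (one_div_le_kVec X hα0 hα hk).trans (le_abs_self _)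
    have h4 : 1 / (n : ℝ) * (|X k| + |z|) ≤ S :=
      (mul_le_mul_of_nonneg_right h3 (by positivity)).trans h2
    rw [one_div, inv_mul_le_iff₀ hn'] at h4
    exact h4
  -- The larger constant is needed only for an untrimmed observation of rank one, where `n |z|` and
  -- the sum of the other observations each contribute `n ^ 2 S`.
  have hle : n * S ≤ 2 * n ^ 2 * S := by
    refine mul_le_mul_of_nonneg_right ?_ hS0
    nlinarith
  obtain ⟨i, hi⟩ := exists_rank_eq hX (r := 2) (by norm_num) hn
  have hzS : |z| ≤ n * S := by linarith [h1 i hi.ge, abs_nonneg (X i)]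
  refine ⟨hzS.trans hle, fun k => ?_⟩
  by_cases hk : 2 ≤ rank X k
  · left; linarith [h1 k hk, abs_nonneg z]
  have hk1 : rank X k = 1 := by have := (rank_mem X k).1; omega
  by_cases hm : 1 ≤ trimCount n α
  · exact Or.inr ⟨hk1, hm⟩
  left
  have hm0 : trimCount n α = 0 := by omega
  -- With nothing trimmed, `z` is the plain mean and determines the remaining observation.
  have hsum : n * z = ∑ j, X j := by
    rw [hz, trimmedMean_eq X hn0 hα0 hα, mul_div_cancel₀ _ hn'.ne']
    refine Finset.sum_congr rfl fun j _ => ?_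
    have := rank_mem X j
    rw [weight_natCast, hm0, if_pos (by omega)]
    simp
  rw [← Finset.add_sum_erase _ _ (Finset.mem_univ k)] at hsum
  have herase : |∑ j ∈ Finset.univ.erase k, X j| ≤ n * (n * S) := by
    refine (Finset.abs_sum_le_sum_abs _ _).trans ?_
    calc _ ≤ ∑ _j ∈ Finset.univ.erase k, n * S := by
          refine Finset.sum_le_sum fun j hj => ?_
          have hjk : rank X j ≠ 1 := fun h =>
            (Finset.ne_of_mem_erase hj) (rank_injective hX (h.trans hk1.symm))
          have := (rank_mem X j).1
          linarith [h1 j (by omega), abs_nonneg z]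
      _ ≤ ∑ _j : Fin n, n * S :=
          Finset.sum_le_sum_of_subset_of_nonneg (Finset.erase_subset _ _)
            fun _ _ _ => by positivity
      _ = _ := by simp
  have hX1 : X k = n * z - ∑ j ∈ Finset.univ.erase k, X j := by linarith
  rw [hX1]
  refine (abs_sub _ _).trans ?_
  rw [abs_mul, abs_of_pos hn']
  have := mul_le_mul_of_nonneg_left hzS hn'.le
  linarith

theorem integral_estimate_error {Ω : Type*} [MeasurableSpace Ω] {μ : Measure Ω}
    [IsProbabilityMeasure μ] {p : Sym2 (Fin n) → ℝ} (hp : ∀ e, 0 ≤ p e)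
    {e : ℕ → Ω → Sym2 (Fin n)} (he : IsEdgeSampling μ p e) (mode : Schedule) (α : ℝ)
    (X : Fin n → ℝ) (t : ℕ) :
    ∫ ω, l2norm (fun k => estimate mode α X (fun s => e s ω) t k - trimmedMean α X) ∂μ
      = pathMean p t fun l => l2norm fun k => (runList mode α X l).num k
        / max 1 ((runList mode α X l).mass k) - trimmedMean α X := by
  simp only [estimate, run_eq_runList]
  exact integral_history hp he t fun l => l2norm fun k => (runList mode α X l).num k
    / max 1 ((runList mode α X l).mass k) - trimmedMean α X

/-- On at most two vertices, the vertices themselves serve as colours. -/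
theorem three_le_of_not_isBipartite {G : SimpleGraph (Fin n)} (hG : ¬ G.IsBipartite) :
    3 ≤ n := by
  by_contra! h
  refine hG ⟨SimpleGraph.Coloring.mk (fun k => ⟨k, by omega⟩) fun {u v} huv h => ?_⟩
  exact huv.ne (Fin.ext (by simpa using h))

end

end GoTrim

/-! ### Geometric decay against the rate `1 / √t` -/

open MeasureTheory GoTrim in
theorem theorem4 :
    ∃ C : ℝ, 0 < C ∧
      ∀ (n : ℕ) (hn : 2 ≤ n) (G : SimpleGraph (Fin n)) (p : Sym2 (Fin n) → ℝ)
        (mode : Schedule),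
        G.Connected → ¬ G.IsBipartite → IsEdgeLaw G p →
        (∀ (α : ℝ) (X : Fin n → ℝ), 0 < α → α < 1 / 2 → Function.Injective X →
          ∃ T : ℝ, 0 < T ∧
            ∀ (Ω : Type*) [MeasurableSpace Ω] (μ : Measure Ω) [IsProbabilityMeasure μ]
              (e : ℕ → Ω → Sym2 (Fin n)), IsEdgeSampling μ p e →
              ∀ t : ℕ, T < t →
                ∫ ω, l2norm (fun k =>
                    estimate mode α X (fun s => e s ω) t k - trimmedMean α X) ∂μ
                  ≤ C / (cTilde hn p * √(spectralGap hn p * t))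
                    * l2norm (fun k => kVec α X k * (X k + |trimmedMean α X|))) ∧
        (∃ T : ℝ, 0 < T ∧
          ∀ (α : ℝ) (X : Fin n → ℝ), 0 < α → α < 1 / 2 → Function.Injective X →
            ∀ (Ω : Type*) [MeasurableSpace Ω] (μ : Measure Ω) [IsProbabilityMeasure μ]
              (e : ℕ → Ω → Sym2 (Fin n)), IsEdgeSampling μ p e →
              ∀ t : ℕ, T < t →
                ∫ ω, l2norm (fun k =>
                    estimate mode α X (fun s => e s ω) t k - trimmedMean α X) ∂μ
                  ≤ C / (cTilde hn p * √(spectralGap hn p * t))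
                    * l2norm (fun k => kVec α X k * (|X k| + |trimmedMean α X|))) := by
  refine ⟨1, one_pos, fun n hn G p mode hG hbip hp => ?_⟩
  have hn3 := three_le_of_not_isBipartite hbip
  have hn' : (0 : ℝ) < n := by positivity
  have hgap := spectralGap_pos hn hG hp
  have hct := cTilde_pos hn hG hp
  obtain ⟨K, r, -, hr0, hr1, hbound⟩ := exists_error_bound hn hG hp mode
  refine ⟨fun α X hα0 hα hX => ?_, ?_⟩
  · set R := l2norm fun k => kVec α X k * (X k + |trimmedMean α X|)
    have hR : 0 < R := by
      obtain ⟨k, hk, hne⟩ := exists_two_le_rank_ne hn3 hX (-|trimmedMean α X|)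
      exact l2norm_kVec_mul_pos (y := fun k => X k + |trimmedMean α X|) hα0 hα hk
        fun h => hne (by linarith)
    set S := 1 + |trimmedMean α X| + ∑ k, |X k| with hS
    have hsum : 0 ≤ ∑ k, |X k| := Finset.sum_nonneg fun _ _ => abs_nonneg _
    -- The threshold may depend on the data here, so any positive `R` will do.
    obtain ⟨T, hT, hTt⟩ := exists_forall_lt_le (K := K) (S / R) hr0 hr1 hgap hct
    refine ⟨T, hT, fun Ω _ μ _ e he t ht => ?_⟩
    rw [integral_estimate_error hp.nonneg he mode α X t]
    refine (hbound α X S hα0 hα hX (by positivity) (by linarith) (fun k => Or.inl ?_) t).trans ?_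
    · have := Finset.single_le_sum (f := fun k => |X k|) (fun _ _ => abs_nonneg _)
        (Finset.mem_univ k)
      linarith [abs_nonneg (trimmedMean α X)]
    · calc _ = √(K * (t + 1) * r ^ t) * (S / R) * R := by field_simp
        _ ≤ _ := mul_le_mul_of_nonneg_right (hTt t ht) hR.le
  -- The ratio of the scales is now bounded in terms of `n` alone, so the threshold is chosen before
  -- the data.
  · obtain ⟨T, hT, hTt⟩ := exists_forall_lt_le (K := K) (2 * n ^ 2) hr0 hr1 hgap hct
    refine ⟨T, hT, fun α X hα0 hα hX Ω _ μ _ e he t ht => ?_⟩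
    rw [integral_estimate_error hp.nonneg he mode α X t]
    set R := l2norm fun k => kVec α X k * (|X k| + |trimmedMean α X|) with hRdef
    have hR : 0 < R := by
      obtain ⟨k, hk, hne⟩ := exists_two_le_rank_ne hn3 hX 0
      exact l2norm_kVec_mul_pos (y := fun k => |X k| + |trimmedMean α X|) hα0 hα hk
        (add_pos_of_pos_of_nonneg (abs_pos.2 hne) (abs_nonneg _)).ne'
    obtain ⟨hz, hXk⟩ := scale_le hn hα0 hα hX hRdef
    refine (hbound α X _ hα0 hα hX (by positivity) hz hXk t).trans ?_
    rw [← mul_assoc]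
    exact mul_le_mul_of_nonneg_right (hTt t ht) hR.le
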